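/- Let $v_{40},v_{22},v_{04},v_{60},v_{42},v_{24},v_{06}\in\mathbb R$ and put $A=\frac38(v_{40}+v_{04})$, $B=\frac34(v_{40}-v_{04})$, $C=\frac18v_{22}$. For $N\in\{1,2\}$ consider the one-degree-of-freedom Hamiltonian system (the reduced $2{:}2$ resonant normal form) $$K(J,\psi;\mathcal E,\delta)=\mathcal E+\sum_{j=1}^N\big(\mathcal A_j+\mathcal B_j\cos2\psi\big),\qquad 0\le J\le\mathcal E,\ \psi\in\mathbb R/2\pi\mathbb Z,$$ with canonically conjugate variables $J,\psi$, where $$\mathcal A_1=(2A-B)\mathcal E^2+(-4A+2B+8C)\mathcal EJ+\delta J+4(A-2C)J^2,\qquad \mathcal B_1=4CJ(\mathcal E-J),$$ $$\begin{aligned}\mathcal A_2={}&\tfrac19\big(68AB-68A^2-17B^2+\tfrac{45}2v_{06}\big)\mathcal E^3+\big(\tfrac{68}3A^2-\tfrac{68}3AB+\tfrac{17}3B^2-32AC+16BC-36C^2+\tfrac32v_{24}-\tfrac{15}2v_{06}\big)\mathcal E^2J-8C\delta\mathcal EJ\\&+\big(\tfrac{68}3AB-\tfrac{68}3A^2-\tfrac{17}3B^2+32AC-48BC+36C^2+\tfrac32v_{42}-3v_{24}+\tfrac{15}2v_{06}\big)\mathcal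 EJ^2+2(4C-2A-B)\delta J^2\\&+\big(32BC+\tfrac52v_{60}-\tfrac{136}9AB-\tfrac32v_{42}+\tfrac32v_{24}-\tfrac52v_{06}\big)J^3,\end{aligned}$$ $$\begin{aligned}\mathcal B_2={}&-4C\delta\mathcal EJ+\big(v_{24}-32C^2-\tfrac{40}3AC+\tfrac{20}3BC\big)\mathcal E^2J+\big(\tfrac{40}3AC-20BC+32C^2+v_{42}-2v_{24}\big)\mathcal EJ^2+4C\delta J^2\\&+\big(\tfrac{40}3BC-v_{42}+v_{24}\big)J^3.\end{aligned}$$ The normal modes are the fixed points $J=0$ (mode 1) and $J=\mathcal E$ (mode 2), studied in the planar coordinates $\sqrt{2J}(\cos\psi,\sin\psi)$ and $\sqrt{2(\mathcal E-J)}(\cos\psi,\sin\psi)$ respectively. Fixed points with $0<J<\mathcal E$ are called inclined if $\psi\in\{0,\pi\}$ and loop if $\psi=\pm\pi/2$. "Stable" means elliptic and "unstable" means hyperbolic. As $\mathcal E$ increases, $(kI)$, resp. $(kL)$, denotes the pitchfork (or anti-pitchfork) bifurcation in which a pair of stable inclined, resp. loop, fixed points branches off from mode $k$ (or disappears into it),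 mode $k$ changing between stable and unstable; $(GB)$ denotes the global bifurcation in which, both modes being unstable, a heteroclinic connection between them exists at the critical value of $\mathcal E$ and at no other value nearby. Assume $C\ne0$, $A-3C>0$, $A-C<0$. Then there are $\delta_0>0$ and $\mathcal E_0>0$, depending only on the coefficients and $N$, such that the following holds for $-\delta_0<\delta<0$ and $0<\mathcal E<\mathcal E_0$. (a) All fixed points with $0<J<\mathcal E$ are inclined or loop, and stable. There are functions $\mathcal E_{1I},\mathcal E_{1L},\mathcal E_{2I},\mathcal E_{2L},\mathcal E_{GB}$ of $\delta$ such that: $(1L)$, a pair of loop fixed points appearing from mode 1, occurs at $\mathcal E_{1L}(\delta)\in(0,\mathcal E_0)$ if $B>2(A-C)$; $(2I)$, a pair of inclined fixed points appearing from mode 2, occurs at $\mathcal E_{2I}(\delta)\in(0,\mathcal E_0)$ if $B>2(3C-A)$; $(1I)$, the pair of inclined fixed points disappearing into mode 1, occurs at $\mathcal E_{1I}(\delta)\in(0,\mathcal E_0)$ if $B>2(A-3C)$; $(2L)$, the pair of loop fixed points disappearing into mode 2, occurs at $\mathcal E_{2L}(\delta)\in(0,\mathcal E_0)$ if $B>2(C-A)$;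 $(GB)$ occurs at $\mathcal E_{GB}(\delta)\in(0,\mathcal E_0)$ if $B>0$. Under the respective conditions, for $N=2$ and $\delta\to0^-$, $$\mathcal E_{1I}=\frac{\delta}{2(2A-B-6C)}+\frac{136A^2+34B^2+280BC+456C^2-8A(17B+70C)+15v_{24}-45v_{06}}{48(2A-B-6C)^3}\delta^2+O(\delta^3),$$ $$\mathcal E_{1L}=\frac{\delta}{2(2A-B-2C)}+\frac{136A^2+34B^2+104BC+72C^2-8A(17B+26C)+3v_{24}-45v_{06}}{48(2A-B-2C)^3}\delta^2+O(\delta^3),$$ $$\mathcal E_{2I}=-\frac{\delta}{2(2A+B-6C)}-\frac{56A^2+14B^2+8A(7B-74C)-296BC+1272C^2+45v_{60}-15v_{42}}{48(2A+B-6C)^3}\delta^2+O(\delta^3),$$ $$\mathcal E_{2L}=-\frac{\delta}{2(2A+B-2C)}-\frac{56A^2+14B^2+8A(7B-22C)-88BC+120C^2+45v_{60}-3v_{42}}{48(2A+B-2C)^3}\delta^2+O(\delta^3),$$ $$\mathcal E_{GB}=-\frac{\delta}{2B}+O(\delta^2),$$ while for $N=1$ and $\delta<0$ close to $0$ each of them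 equals its term linear in $\delta$. (b) If all five conditions on $B$ hold (so that all thresholds are positive), then these thresholds are the only bifurcation values of $\mathcal E$ in $(0,\mathcal E_0)$: at every other value all fixed points are non-degenerate and there is no heteroclinic connection between the modes. The full bifurcation sequence, for increasing $\mathcal E$ and with strict inequalities between the thresholds, is $(1L)$-$(2I)$-$(GB)$-$(1I)$-$(2L)$ if $A-2C<0<A-3C$; $(2I)$-$(1L)$-$(GB)$-$(2L)$-$(1I)$ if $0<A-2C<A-3C$; $(1L)$-$(GB)$-$(1I)$ if $A=2C$: here $(1L)$ is concurrent with $(2I)$ and $(1I)$ with $(2L)$, and $\mathcal E_{1L},\mathcal E_{2I}<\mathcal E_{GB}<\mathcal E_{1I},\mathcal E_{2L}$. (c) Concurrent in (b) means: for $A=2C$ and $\delta\to0^-$, if $B>2C$ then $\mathcal E_{1L}=\mathcal E_{2I}$, and if $B>-2C$ then $\mathcal E_{1I}=\mathcal E_{2L}$, exactly for $N=1$ and up to $O(\delta^2)$ for $N=2$. -/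

import Mathlib

open Set Filter Topology Asymptotics

noncomputable section

namespace Resonance22

/-- The coefficients of the perturbation
`H₂ = v40 x₁⁴ + v22 x₁² x₂² + v04 x₂⁴`,
`H₄ = v60 x₁⁶ + v42 x₁⁴ x₂² + v24 x₁² x₂⁴ + v06 x₂⁶`. -/
structure Coeffs where
  v40 : ℝ
  v22 : ℝ
  v04 : ℝ
  v60 : ℝ
  v42 : ℝ
  v24 : ℝ
  v06 : ℝ

namespace Coeffs

variable (c : Coeffs)

def A : ℝ := 3 / 8 * (c.v40 + c.v04)
def B : ℝ := 3 / 4 * (c.v40 - c.v04)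
def C : ℝ := 1 / 8 * c.v22

end Coeffs

/-! ### The one-degree-of-freedom system -/

/-- The polynomial `𝒜_j (J; E, δ)`, the phase independent part of order `j` (`j = 1, 2`). -/
def polyA (c : Coeffs) (δ E J : ℝ) : ℕ → ℝ
  | 1 => (2 * c.A - c.B) * E ^ 2 + (-4 * c.A + 2 * c.B + 8 * c.C) * E * J + δ * J
      + 4 * (c.A - 2 * c.C) * J ^ 2
  | 2 => 1 / 9 * (68 * c.A * c.B - 68 * c.A ^ 2 - 17 * c.B ^ 2 + 45 / 2 * c.v06) * E ^ 3
      + (68 / 3 * c.A ^ 2 - 68 / 3 * c.A * c.B + 17 / 3 * c.B ^ 2 - 32 * c.A * c.C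
          + 16 * c.B * c.C - 36 * c.C ^ 2 + 3 / 2 * c.v24 - 15 / 2 * c.v06) * E ^ 2 * J
      - 8 * c.C * δ * E * J
      + (68 / 3 * c.A * c.B - 68 / 3 * c.A ^ 2 - 17 / 3 * c.B ^ 2 + 32 * c.A * c.C
          - 48 * c.B * c.C + 36 * c.C ^ 2 + 3 / 2 * c.v42 - 3 * c.v24
          + 15 / 2 * c.v06) * E * J ^ 2
      + 2 * (4 * c.C - 2 * c.A - c.B) * δ * J ^ 2
      + (32 * c.B * c.C + 5 / 2 * c.v60 - 136 / 9 * c.A * c.B - 3 / 2 * c.v42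
          + 3 / 2 * c.v24 - 5 / 2 * c.v06) * J ^ 3
  | _ => 0

/-- The polynomial `ℬ_j (J; E, δ)`, the coefficient of `cos 2ψ` of order `j` (`j = 1, 2`). -/
def polyB (c : Coeffs) (δ E J : ℝ) : ℕ → ℝ
  | 1 => 4 * c.C * J * (E - J)
  | 2 => -4 * c.C * δ * E * J
      + (c.v24 - 32 * c.C ^ 2 - 40 / 3 * c.A * c.C + 20 / 3 * c.B * c.C) * E ^ 2 * J
      + (40 / 3 * c.A * c.C - 20 * c.B * c.C + 32 * c.C ^ 2 + c.v42 - 2 * c.v24) * E * J ^ 2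
      + 4 * c.C * δ * J ^ 2
      + (40 / 3 * c.B * c.C - c.v42 + c.v24) * J ^ 3
  | _ => 0

/-- The Hamiltonian of the 1DOF system, as a function of `(J, ψ)`:
`K = E + ∑_{j=1}^N (𝒜_j + ℬ_j cos 2ψ)`, with phase space `0 ≤ J ≤ E`, `ψ` an angle. -/
def ham (c : Coeffs) (N : ℕ) (δ E : ℝ) (p : ℝ × ℝ) : ℝ :=
  E + ∑ j ∈ Finset.Icc 1 N, (polyA c δ E p.1 j + polyB c δ E p.1 j * Real.cos (2 * p.2))

/-- The Hamiltonian in the planar coordinates `x = √(2J) cos ψ`, `y = √(2J) sin ψ`, which are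
regular at the normal mode `J = 0`. That mode ("mode 1") is the origin. -/
def chart1 (c : Coeffs) (N : ℕ) (δ E : ℝ) (p : ℝ × ℝ) : ℝ :=
  ham c N δ E ((p.1 ^ 2 + p.2 ^ 2) / 2, Complex.arg ⟨p.1, p.2⟩)

/-- The Hamiltonian in the planar coordinates `x' = √(2(E - J)) cos ψ`, `y' = √(2(E - J)) sin ψ`,
which are regular at the normal mode `J = E`. That mode ("mode 2") is the origin. -/
def chart2 (c : Coeffs) (N : ℕ) (δ E : ℝ) (p : ℝ × ℝ) : ℝ :=
  ham c N δ E (E - (p.1 ^ 2 + p.2 ^ 2) / 2, Complex.arg ⟨p.1, p.2⟩)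

/-! ### Planar Hamiltonian systems

All Hamiltonians to which these definitions are applied are smooth. -/

/-- Partial derivative with respect to the first variable. -/
def pd1 (F : ℝ × ℝ → ℝ) (p : ℝ × ℝ) : ℝ := deriv (fun t => F (t, p.2)) p.1

/-- Partial derivative with respect to the second variable. -/
def pd2 (F : ℝ × ℝ → ℝ) (p : ℝ × ℝ) : ℝ := deriv (fun t => F (p.1, t)) p.2

/-- The Hamiltonian vector field of `F`. -/
def hamField (F : ℝ × ℝ → ℝ) (p : ℝ × ℝ) : ℝ × ℝ := (pd2 F p, -pd1 F p)

/-- The linearisation (Jacobian matrix) of the Hamiltonian vector field of `F` at `p`. -/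
def linearisation (F : ℝ × ℝ → ℝ) (p : ℝ × ℝ) : Matrix (Fin 2) (Fin 2) ℝ :=
  !![pd1 (pd2 F) p, pd2 (pd2 F) p; -pd1 (pd1 F) p, -pd2 (pd1 F) p]

/-- Fixed points. -/
def IsEquilibrium (F : ℝ × ℝ → ℝ) (p : ℝ × ℝ) : Prop := hamField F p = 0

/-- Stable (elliptic) fixed points: the eigenvalues are `± i ω` with `ω > 0`. -/
def IsCenter (F : ℝ × ℝ → ℝ) (p : ℝ × ℝ) : Prop :=
  IsEquilibrium F p ∧ ∃ ω : ℝ, 0 < ω ∧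
    (linearisation F p).charpoly = Polynomial.X ^ 2 + Polynomial.C (ω ^ 2)

/-- Unstable (hyperbolic) fixed points: the eigenvalues are `± κ` with `κ > 0`. -/
def IsSaddle (F : ℝ × ℝ → ℝ) (p : ℝ × ℝ) : Prop :=
  IsEquilibrium F p ∧ ∃ κ : ℝ, 0 < κ ∧
    (linearisation F p).charpoly = Polynomial.X ^ 2 - Polynomial.C (κ ^ 2)

/-- A pitchfork bifurcation of the family `H E` at the origin, when `E` increases through `s`:
the origin is stable, and locally the only fixed point, for `E < s`; for `E > s` it is unstable,
and a pair of stable fixed points `± a(E) e` has branched off from it in the direction `e`. -/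
def IsPitchfork (H : ℝ → ℝ × ℝ → ℝ) (e : ℝ × ℝ) (s : ℝ) : Prop :=
  ∃ r > 0, ∃ η > 0, ∃ a : ℝ → ℝ,
    (∀ E ∈ Ioo (s - η) s, IsCenter (H E) 0) ∧
    (∀ E ∈ Ioc (s - η) s, ∀ p ∈ Metric.ball (0 : ℝ × ℝ) r, IsEquilibrium (H E) p ↔ p = 0) ∧
    (∀ E ∈ Ioo s (s + η), IsSaddle (H E) 0 ∧ 0 < a E ∧
      IsCenter (H E) (a E • e) ∧ IsCenter (H E) (-(a E • e)) ∧
      ∀ p ∈ Metric.ball (0 : ℝ × ℝ) r,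
        IsEquilibrium (H E) p ↔ p = 0 ∨ p = a E • e ∨ p = -(a E • e)) ∧
    Tendsto a (𝓝[>] s) (𝓝 0)

/-- An anti-pitchfork bifurcation: a pitchfork bifurcation when `E` decreases through `s`
(a pair of stable fixed points disappears into the origin when `E` increases). -/
def IsAntiPitchfork (H : ℝ → ℝ × ℝ → ℝ) (e : ℝ × ℝ) (s : ℝ) : Prop :=
  IsPitchfork (fun t => H (-t)) e (-s)

/-! ### The bifurcations of the 1DOF system

A digit is the normal mode at which the pair of fixed points appears or disappears; `I` stands
for the stable inclined family (`ψ = 0, π`, the first axis of the planar charts) and `L` for the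
stable loop family (`ψ = ± π / 2`, the second axis). -/

/-- (1I): the pair of stable inclined fixed points disappears into mode 1. -/
def Bif1I (c : Coeffs) (N : ℕ) (δ s : ℝ) : Prop := IsAntiPitchfork (chart1 c N δ) (1, 0) s

/-- (1L): a pair of stable loop fixed points appears from mode 1. -/
def Bif1L (c : Coeffs) (N : ℕ) (δ s : ℝ) : Prop := IsPitchfork (chart1 c N δ) (0, 1) s

/-- (2I): a pair of stable inclined fixed points appears from mode 2. -/
def Bif2I (c : Coeffs) (N : ℕ) (δ s : ℝ) : Prop := IsPitchfork (chart2 c N δ) (1, 0) s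

/-- (2L): the pair of stable loop fixed points disappears into mode 2. -/
def Bif2L (c : Coeffs) (N : ℕ) (δ s : ℝ) : Prop := IsAntiPitchfork (chart2 c N δ) (0, 1) s

/-- There is a heteroclinic orbit from mode 1 (`J = 0`) to mode 2 (`J = E`); by the reversing
symmetry `ψ ↦ -ψ` there is then also one from mode 2 to mode 1. -/
def HasHeteroclinic (c : Coeffs) (N : ℕ) (δ E : ℝ) : Prop :=
  ∃ γ : ℝ → ℝ × ℝ,
    (∀ t, HasDerivAt γ (hamField (ham c N δ E) (γ t)) t ∧ (γ t).1 ∈ Ioo 0 E) ∧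
    Tendsto (fun t => (γ t).1) atBot (𝓝 0) ∧ Tendsto (fun t => (γ t).1) atTop (𝓝 E)

/-- (GB): the global bifurcation. For `E` near `s` both modes are unstable, and their
separatrices are connected to each other for `E = s` only. -/
def BifGB (c : Coeffs) (N : ℕ) (δ s : ℝ) : Prop :=
  ∃ η > 0, ∀ E ∈ Ioo (s - η) (s + η),
    IsSaddle (chart1 c N δ E) 0 ∧ IsSaddle (chart2 c N δ E) 0 ∧
      (HasHeteroclinic c N δ E ↔ E = s)

/-- The value `E` is regular (no bifurcation takes place): all fixed points, that is the two modes
and those with `0 < J < E`, are non-degenerate, and the modes are not connected to each other. -/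
def IsRegularEnergy (c : Coeffs) (N : ℕ) (δ E : ℝ) : Prop :=
  (IsCenter (chart1 c N δ E) 0 ∨ IsSaddle (chart1 c N δ E) 0) ∧
  (IsCenter (chart2 c N δ E) 0 ∨ IsSaddle (chart2 c N δ E) 0) ∧
  (∀ p : ℝ × ℝ, p.1 ∈ Ioo 0 E → IsEquilibrium (ham c N δ E) p →
    IsCenter (ham c N δ E) p ∨ IsSaddle (ham c N δ E) p) ∧
  ¬ HasHeteroclinic c N δ E

/-! ### The bifurcation curves `E = lead · δ + quad · δ²` -/

def lead1I (c : Coeffs) : ℝ := 1 / (2 * (2 * c.A - c.B - 6 * c.C))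
def lead1L (c : Coeffs) : ℝ := 1 / (2 * (2 * c.A - c.B - 2 * c.C))
def lead2I (c : Coeffs) : ℝ := -1 / (2 * (2 * c.A + c.B - 6 * c.C))
def lead2L (c : Coeffs) : ℝ := -1 / (2 * (2 * c.A + c.B - 2 * c.C))
def leadGB (c : Coeffs) : ℝ := -1 / (2 * c.B)

def quad1I (c : Coeffs) : ℝ :=
  (136 * c.A ^ 2 + 34 * c.B ^ 2 + 280 * c.B * c.C + 456 * c.C ^ 2
    - 8 * c.A * (17 * c.B + 70 * c.C) + 15 * c.v24 - 45 * c.v06)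
    / (48 * (2 * c.A - c.B - 6 * c.C) ^ 3)

def quad1L (c : Coeffs) : ℝ :=
  (136 * c.A ^ 2 + 34 * c.B ^ 2 + 104 * c.B * c.C + 72 * c.C ^ 2
    - 8 * c.A * (17 * c.B + 26 * c.C) + 3 * c.v24 - 45 * c.v06)
    / (48 * (2 * c.A - c.B - 2 * c.C) ^ 3)

def quad2I (c : Coeffs) : ℝ :=
  -(56 * c.A ^ 2 + 14 * c.B ^ 2 + 8 * c.A * (7 * c.B - 74 * c.C) - 296 * c.B * c.C
    + 1272 * c.C ^ 2 + 45 * c.v60 - 15 * c.v42)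
    / (48 * (2 * c.A + c.B - 6 * c.C) ^ 3)

def quad2L (c : Coeffs) : ℝ :=
  -(56 * c.A ^ 2 + 14 * c.B ^ 2 + 8 * c.A * (7 * c.B - 22 * c.C) - 88 * c.B * c.C
    + 120 * c.C ^ 2 + 45 * c.v60 - 3 * c.v42)
    / (48 * (2 * c.A + c.B - 2 * c.C) ^ 3)

/-- The expansion of a pitchfork threshold for `δ → 0⁻`: exactly linear for the system truncated
at `N = 1`, and known up to terms of third order for `N = 2`. -/
def HasExpansion (N : ℕ) (f : ℝ → ℝ) (lead quad : ℝ) : Prop :=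
  (N = 1 → ∀ᶠ δ in 𝓝[<] (0 : ℝ), f δ = lead * δ) ∧
  (N = 2 → (fun δ => f δ - (lead * δ + quad * δ ^ 2)) =O[𝓝[<] (0 : ℝ)] fun δ => δ ^ 3)

/-- Two quantities agree to first order in `δ → 0⁻`: exactly for the system truncated at `N = 1`,
and up to terms of second order for `N = 2`. -/
def AgreeToFirstOrder (N : ℕ) (f g : ℝ → ℝ) : Prop :=
  (N = 1 → ∀ᶠ δ in 𝓝[<] (0 : ℝ), f δ = g δ) ∧
  (N = 2 → (fun δ => f δ - g δ) =O[𝓝[<] (0 : ℝ)] fun δ => δ ^ 2)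

end Resonance22

end

open Resonance22

/-!
# Bifurcations of the normal modes in the reduced `2 : 2` resonance

The Hamiltonian has the form `(P + M) / 2 + (P - M) / 2 · cos 2ψ`, where the cubic polynomials `P`
and `M` in `J` are its restrictions to the inclined phase `ψ = 0` and to the loop phase `ψ = π / 2`.
The assumptions on the coefficients force `C < 0`. They imply, for small `E` and `δ`, that
`P - M = 2 J (E - J) (b₀ + b₁ J)` is negative for `0 < J < E`, that `P'' ≈ 8 (A - 3C)` is positive
and that `M'' ≈ 8 (A - C)` is negative (`IsSmall`). Hence critical points with `0 < J < E` lie on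
`sin 2ψ = 0`, where they are critical points of `P` or of `M`, and all of them are centres
(`isCenter_phaseHam`).

Near a normal mode the planar Hamiltonian is
`k + (p₁ + p₂ J + p₃ J²) x² / 2 + (m₁ + m₂ J + m₃ J²) y² / 2`, where `p` and `m` are the Taylor
coefficients of `P` and `M` at that mode. The mode is a centre or a saddle according to the sign of
`p₁ m₁`, and a sign change of `p₁` or `m₁` produces a pitchfork bifurcation (`isPitchfork_planar`).
So the four pitchfork thresholds are the zeros of `P'(0)`, `M'(0)`, `P'(E)` and `M'(E)` as functions
of the energy.

A connection between the modes needs `P(0) = P(E)`, since the Hamiltonian is constant along it.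
Conversely, if this holds then the level set through the modes is a graph `ψ = ψ(J)` over
`0 < J < E`, and the motion on it is a scalar equation `J' = J (E - J) w(J)` with `w > 0`, whose
solution runs from one mode to the other (`exists_connecting_orbit`).

Each of the five functions, in the last case `(P(E) - P(0)) / E`, has the form
`δ + m E + α E² + β δ E`. For `m > 0` it changes sign exactly once, at an explicit root whose
expansion is `-δ / m + (β m - α) / m³ · δ² + O(δ³)` (`threshold`). By convexity of `P` and concavity
of `M`, the chord slope `(P(E) - P(0)) / E` lies between the slopes at the ends, which places the
global bifurcation between the others. The remaining comparisons come from
`P'(E) - M'(0) ≈ 8 (A - 2C) E ≈ M'(E) - P'(0)`.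
-/

namespace Resonance22

/-! ### Planar Hamiltonian systems -/

/-- For a Hamiltonian linearisation, being elliptic means zero trace and positive determinant. -/
theorem isCenter_iff (F : ℝ × ℝ → ℝ) (p : ℝ × ℝ) :
    IsCenter F p ↔ IsEquilibrium F p ∧ (linearisation F p).trace = 0 ∧
      0 < (linearisation F p).det := by
  unfold IsCenter
  refine and_congr_right fun _ => ⟨?_, ?_⟩
  · rintro ⟨ω, hω, h⟩
    rw [Matrix.charpoly_fin_two] at h
    have h0 := congrArg (fun q => Polynomial.coeff q 0) h
    have h1 := congrArg (fun q => Polynomial.coeff q 1) h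
    simp [Polynomial.coeff_X, Polynomial.coeff_C, Polynomial.coeff_X_pow, -map_pow] at h0 h1
    refine ⟨h1, ?_⟩
    rw [h0]
    positivity
  · rintro ⟨h1, h2⟩
    refine ⟨√(linearisation F p).det, Real.sqrt_pos.2 h2, ?_⟩
    rw [Matrix.charpoly_fin_two, h1, Real.sq_sqrt h2.le]
    simp

/-- For a Hamiltonian linearisation, being hyperbolic means zero trace and negative
determinant. -/
theorem isSaddle_iff (F : ℝ × ℝ → ℝ) (p : ℝ × ℝ) :
    IsSaddle F p ↔ IsEquilibrium F p ∧ (linearisation F p).trace = 0 ∧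
      (linearisation F p).det < 0 := by
  unfold IsSaddle
  refine and_congr_right fun _ => ⟨?_, ?_⟩
  · rintro ⟨κ, hκ, h⟩
    rw [Matrix.charpoly_fin_two] at h
    have h0 := congrArg (fun q => Polynomial.coeff q 0) h
    have h1 := congrArg (fun q => Polynomial.coeff q 1) h
    simp [Polynomial.coeff_X, Polynomial.coeff_C, Polynomial.coeff_X_pow, -map_pow] at h0 h1
    refine ⟨h1, ?_⟩
    rw [h0]
    have : 0 < κ ^ 2 := by positivity
    linarith
  · rintro ⟨h1, h2⟩
    refine ⟨√(-(linearisation F p).det), Real.sqrt_pos.2 (by linarith), ?_⟩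
    rw [Matrix.charpoly_fin_two, h1, Real.sq_sqrt (by linarith)]
    simp

theorem isEquilibrium_iff (F : ℝ × ℝ → ℝ) (p : ℝ × ℝ) :
    IsEquilibrium F p ↔ pd1 F p = 0 ∧ pd2 F p = 0 := by
  simp [IsEquilibrium, hamField, Prod.ext_iff, and_comm]

theorem trace_linearisation (F : ℝ × ℝ → ℝ) (p : ℝ × ℝ) :
    (linearisation F p).trace = pd1 (pd2 F) p - pd2 (pd1 F) p := by
  simp [linearisation, Matrix.trace_fin_two, sub_eq_add_neg]

theorem det_linearisation (F : ℝ × ℝ → ℝ) (p : ℝ × ℝ) :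
    (linearisation F p).det
      = pd1 (pd1 F) p * pd2 (pd2 F) p - pd1 (pd2 F) p * pd2 (pd1 F) p := by
  simp [linearisation, Matrix.det_fin_two]
  ring

/-- Reversing the sign of the Hamiltonian and exchanging the two coordinates. It preserves fixed
points together with their type. -/
def negSwap (F : ℝ × ℝ → ℝ) (p : ℝ × ℝ) : ℝ := -F p.swap

theorem pd1_negSwap (F : ℝ × ℝ → ℝ) : pd1 (negSwap F) = negSwap (pd2 F) := by
  funext p
  simp [pd1, pd2, negSwap, Prod.swap]

theorem pd2_negSwap (F : ℝ × ℝ → ℝ) : pd2 (negSwap F) = negSwap (pd1 F) := by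
  funext p
  simp [pd1, pd2, negSwap, Prod.swap]

theorem isEquilibrium_negSwap (F : ℝ × ℝ → ℝ) (p : ℝ × ℝ) :
    IsEquilibrium (negSwap F) p ↔ IsEquilibrium F p.swap := by
  rw [isEquilibrium_iff, isEquilibrium_iff, pd1_negSwap, pd2_negSwap]
  simp [negSwap, and_comm]

theorem trace_linearisation_negSwap (F : ℝ × ℝ → ℝ) (p : ℝ × ℝ) :
    (linearisation (negSwap F) p).trace = (linearisation F p.swap).trace := by
  simp only [trace_linearisation, pd1_negSwap, pd2_negSwap]
  simp only [negSwap]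
  ring

theorem det_linearisation_negSwap (F : ℝ × ℝ → ℝ) (p : ℝ × ℝ) :
    (linearisation (negSwap F) p).det = (linearisation F p.swap).det := by
  simp only [det_linearisation, pd1_negSwap, pd2_negSwap]
  simp only [negSwap]
  ring

theorem isCenter_negSwap (F : ℝ × ℝ → ℝ) (p : ℝ × ℝ) :
    IsCenter (negSwap F) p ↔ IsCenter F p.swap := by
  rw [isCenter_iff, isCenter_iff, isEquilibrium_negSwap, trace_linearisation_negSwap,
    det_linearisation_negSwap]

theorem isSaddle_negSwap (F : ℝ × ℝ → ℝ) (p : ℝ × ℝ) :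
    IsSaddle (negSwap F) p ↔ IsSaddle F p.swap := by
  rw [isSaddle_iff, isSaddle_iff, isEquilibrium_negSwap, trace_linearisation_negSwap,
    det_linearisation_negSwap]

theorem IsPitchfork.negSwap {H : ℝ → ℝ × ℝ → ℝ} {e : ℝ × ℝ} {s : ℝ} (h : IsPitchfork H e s) :
    IsPitchfork (fun t => Resonance22.negSwap (H t)) e.swap s := by
  obtain ⟨r, hr, η, hη, a, h1, h2, h3, h4⟩ := h
  have hball : ∀ p : ℝ × ℝ, p ∈ Metric.ball (0 : ℝ × ℝ) r → p.swap ∈ Metric.ball (0 : ℝ × ℝ) r := by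
    intro p hp
    simp only [Metric.mem_ball, Prod.dist_eq, Prod.fst_zero, Prod.snd_zero, Prod.fst_swap,
      Prod.snd_swap] at hp ⊢
    rwa [max_comm]
  have hs : ∀ p q : ℝ × ℝ, p.swap = q ↔ p = q.swap := fun p q =>
    ⟨fun h => by rw [← h, Prod.swap_swap], fun h => by rw [h, Prod.swap_swap]⟩
  refine ⟨r, hr, η, hη, a, fun E hE => ?_, fun E hE p hp => ?_, fun E hE => ?_, h4⟩
  · rw [isCenter_negSwap]
    exact h1 E hE
  · rw [isEquilibrium_negSwap, h2 E hE _ (hball p hp), hs]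
    rfl
  · obtain ⟨g1, g2, g3, g4, g5⟩ := h3 E hE
    refine ⟨(isSaddle_negSwap _ _).2 g1, g2, (isCenter_negSwap _ _).2 ?_,
      (isCenter_negSwap _ _).2 ?_, fun p hp => ?_⟩
    · simpa using g3
    · simpa using g4
    · rw [isEquilibrium_negSwap, g5 _ (hball p hp), hs, hs, hs]
      simp

/-! ### The normal form at a normal mode -/

/-- The Hamiltonian `k + (p₁ + p₂ J + p₃ J²) x² / 2 + (m₁ + m₂ J + m₃ J²) y² / 2`, where
`J = (x² + y²) / 2`. On the two axes it equals `k + p₁ J + p₂ J² + p₃ J³` and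
`k + m₁ J + m₂ J² + m₃ J³`. -/
noncomputable def planar (k p1 p2 p3 m1 m2 m3 : ℝ) (q : ℝ × ℝ) : ℝ :=
  k + (p1 + p2 * ((q.1 ^ 2 + q.2 ^ 2) / 2) + p3 * ((q.1 ^ 2 + q.2 ^ 2) / 2) ^ 2) * (q.1 ^ 2 / 2)
    + (m1 + m2 * ((q.1 ^ 2 + q.2 ^ 2) / 2) + m3 * ((q.1 ^ 2 + q.2 ^ 2) / 2) ^ 2) * (q.2 ^ 2 / 2)

/-- The cofactor of `x` in `∂F/∂x`, for `F = planar k p₁ p₂ p₃ m₁ m₂ m₃`; with the roles of `p`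
and `m` and of the coordinates exchanged, it is the cofactor of `y` in `∂F/∂y`. -/
noncomputable def cofactor (p1 p2 p3 m2 m3 x y : ℝ) : ℝ :=
  p1 + p2 * ((x ^ 2 + y ^ 2) / 2) + p3 * ((x ^ 2 + y ^ 2) / 2) ^ 2
    + (p2 + 2 * p3 * ((x ^ 2 + y ^ 2) / 2)) * (x ^ 2 / 2)
    + (m2 + 2 * m3 * ((x ^ 2 + y ^ 2) / 2)) * (y ^ 2 / 2)

section Planar

variable (k p1 p2 p3 m1 m2 m3 : ℝ)

theorem negSwap_planar :
    negSwap (planar k p1 p2 p3 m1 m2 m3) = planar (-k) (-m1) (-m2) (-m3) (-p1) (-p2) (-p3) := by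
  funext q
  simp only [negSwap, planar, Prod.fst_swap, Prod.snd_swap]
  ring

theorem hasDerivAt_radius (x y : ℝ) : HasDerivAt (fun t : ℝ => (t ^ 2 + y ^ 2) / 2) x x :=
  (((hasDerivAt_pow 2 x).add_const (y ^ 2)).div_const 2).congr_deriv (by simp)

theorem hasDerivAt_half_sq (x : ℝ) : HasDerivAt (fun t : ℝ => t ^ 2 / 2) x x :=
  ((hasDerivAt_pow 2 x).div_const 2).congr_deriv (by simp)

theorem pd1_planar (q : ℝ × ℝ) :
    pd1 (planar k p1 p2 p3 m1 m2 m3) q = q.1 * cofactor p1 p2 p3 m2 m3 q.1 q.2 := by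
  obtain ⟨x, y⟩ := q
  have hJ := hasDerivAt_radius x y
  have hX := hasDerivAt_half_sq x
  refine HasDerivAt.deriv (((((((hJ.const_mul p2).const_add p1).add
    ((hJ.pow 2).const_mul p3)).mul hX).const_add k).add
    ((((hJ.const_mul m2).const_add m1).add ((hJ.pow 2).const_mul m3)).mul_const
      (y ^ 2 / 2))).congr_deriv ?_)
  simp only [cofactor, Pi.add_apply, Pi.pow_apply]
  ring

theorem pd2_planar (q : ℝ × ℝ) :
    pd2 (planar k p1 p2 p3 m1 m2 m3) q = q.2 * cofactor m1 m2 m3 p2 p3 q.2 q.1 := by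
  have h := congrFun (pd2_negSwap (planar k p1 p2 p3 m1 m2 m3)) q.swap
  have h' := congrFun (pd1_negSwap (planar k p1 p2 p3 m1 m2 m3)) q.swap
  rw [negSwap_planar, pd1_planar] at h'
  simp only [negSwap, Prod.swap_swap, Prod.fst_swap, Prod.snd_swap] at h'
  rw [← neg_eq_iff_eq_neg.2 h']
  simp only [cofactor]
  ring

/-- The derivative of `cofactor` in its first coordinate. -/
theorem hasDerivAt_cofactor_fst (x y : ℝ) :
    HasDerivAt (fun t => cofactor p1 p2 p3 m2 m3 t y)
      (x * (2 * p2 + 4 * p3 * ((x ^ 2 + y ^ 2) / 2) + p3 * x ^ 2 + m3 * y ^ 2)) x := by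
  have hJ := hasDerivAt_radius x y
  have hX := hasDerivAt_half_sq x
  refine ((((hJ.const_mul p2).const_add p1).add ((hJ.pow 2).const_mul p3)).add
    (((hJ.const_mul (2 * p3)).const_add p2).mul hX)).add
    (((hJ.const_mul (2 * m3)).const_add m2).mul_const (y ^ 2 / 2)) |>.congr_deriv ?_
  ring

theorem hasDerivAt_mul_cofactor (x y : ℝ) :
    HasDerivAt (fun t => t * cofactor p1 p2 p3 m2 m3 t y)
      (cofactor p1 p2 p3 m2 m3 x y
        + x * (x * (2 * p2 + 4 * p3 * ((x ^ 2 + y ^ 2) / 2) + p3 * x ^ 2 + m3 * y ^ 2))) x :=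
  ((hasDerivAt_id' x).mul (hasDerivAt_cofactor_fst p1 p2 p3 m2 m3 x y)).congr_deriv (by ring)

/-- The derivative of `cofactor` in its second coordinate. -/
theorem hasDerivAt_cofactor_snd (x y : ℝ) :
    HasDerivAt (fun t => cofactor p1 p2 p3 m2 m3 x t)
      (y * (p2 + m2 + 2 * (p3 + m3) * ((x ^ 2 + y ^ 2) / 2) + p3 * x ^ 2 + m3 * y ^ 2)) y := by
  have hJ : HasDerivAt (fun t : ℝ => (x ^ 2 + t ^ 2) / 2) y y := by
    simpa [add_comm] using hasDerivAt_radius y x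
  have hY := hasDerivAt_half_sq y
  refine ((((hJ.const_mul p2).const_add p1).add ((hJ.pow 2).const_mul p3)).add
    (((hJ.const_mul (2 * p3)).const_add p2).mul_const (x ^ 2 / 2))).add
    (((hJ.const_mul (2 * m3)).const_add m2).mul hY) |>.congr_deriv ?_
  ring

theorem isEquilibrium_planar (q : ℝ × ℝ) :
    IsEquilibrium (planar k p1 p2 p3 m1 m2 m3) q ↔
      q.1 * cofactor p1 p2 p3 m2 m3 q.1 q.2 = 0 ∧
        q.2 * cofactor m1 m2 m3 p2 p3 q.2 q.1 = 0 := by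
  rw [isEquilibrium_iff, pd1_planar, pd2_planar]

theorem trace_linearisation_planar (q : ℝ × ℝ) :
    (linearisation (planar k p1 p2 p3 m1 m2 m3) q).trace = 0 := by
  have h1 : pd1 (planar k p1 p2 p3 m1 m2 m3)
      = fun q => q.1 * cofactor p1 p2 p3 m2 m3 q.1 q.2 := funext (pd1_planar _ _ _ _ _ _ _)
  have h2 : pd2 (planar k p1 p2 p3 m1 m2 m3)
      = fun q => q.2 * cofactor m1 m2 m3 p2 p3 q.2 q.1 := funext (pd2_planar _ _ _ _ _ _ _)
  rw [trace_linearisation, h1, h2]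
  simp only [pd1, pd2]
  rw [((hasDerivAt_cofactor_snd _ _ _ _ _ _ _).const_mul _).deriv,
    ((hasDerivAt_cofactor_snd _ _ _ _ _ _ _).const_mul _).deriv]
  ring

/-- The determinant of the linearisation on the first axis. -/
theorem det_linearisation_planar_axis (x : ℝ) :
    (linearisation (planar k p1 p2 p3 m1 m2 m3) (x, 0)).det
      = (cofactor p1 p2 p3 m2 m3 x 0 + x ^ 2 * (2 * p2 + 3 * p3 * x ^ 2))
        * cofactor m1 m2 m3 p2 p3 0 x := by
  have h1 : pd1 (planar k p1 p2 p3 m1 m2 m3)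
      = fun q => q.1 * cofactor p1 p2 p3 m2 m3 q.1 q.2 := funext (pd1_planar _ _ _ _ _ _ _)
  have h2 : pd2 (planar k p1 p2 p3 m1 m2 m3)
      = fun q => q.2 * cofactor m1 m2 m3 p2 p3 q.2 q.1 := funext (pd2_planar _ _ _ _ _ _ _)
  rw [det_linearisation, h1, h2]
  simp only [pd1, pd2]
  rw [((hasDerivAt_cofactor_snd _ _ _ _ _ _ _).const_mul _).deriv,
    ((hasDerivAt_cofactor_snd _ _ _ _ _ _ _).const_mul _).deriv,
    (hasDerivAt_mul_cofactor _ _ _ _ _ _ _).deriv, (hasDerivAt_mul_cofactor _ _ _ _ _ _ _).deriv]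
  ring

theorem isCenter_planar_zero :
    IsCenter (planar k p1 p2 p3 m1 m2 m3) 0 ↔ 0 < p1 * m1 := by
  have h := det_linearisation_planar_axis k p1 p2 p3 m1 m2 m3 0
  rw [show ((0 : ℝ), (0 : ℝ)) = 0 from rfl] at h
  rw [isCenter_iff, isEquilibrium_planar, trace_linearisation_planar, h]
  simp [cofactor]

theorem isSaddle_planar_zero :
    IsSaddle (planar k p1 p2 p3 m1 m2 m3) 0 ↔ p1 * m1 < 0 := by
  have h := det_linearisation_planar_axis k p1 p2 p3 m1 m2 m3 0
  rw [show ((0 : ℝ), (0 : ℝ)) = 0 from rfl] at h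
  rw [isSaddle_iff, isEquilibrium_planar, trace_linearisation_planar, h]
  simp [cofactor]

end Planar

/-! ### The pitchfork bifurcation of the normal form -/

/-- The root of `p₁ + 2 p₂ J + 3 p₃ J²` that vanishes together with `p₁`, when `p₂ > 0`. This form
of the quadratic formula also covers `p₃ = 0`. -/
noncomputable def smallRoot (p1 p2 p3 : ℝ) : ℝ := -p1 / (p2 + √(p2 ^ 2 - 3 * p1 * p3))

theorem smallRoot_spec {p1 p2 p3 : ℝ} (h2 : 0 < p2) (hd : 0 < p2 ^ 2 - 3 * p1 * p3) :
    p1 + 2 * p2 * smallRoot p1 p2 p3 + 3 * p3 * smallRoot p1 p2 p3 ^ 2 = 0 := by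
  unfold smallRoot
  set S := √(p2 ^ 2 - 3 * p1 * p3) with hS
  have hS2 : S ^ 2 = p2 ^ 2 - 3 * p1 * p3 := Real.sq_sqrt hd.le
  have hpos : 0 < p2 + S := add_pos h2 (Real.sqrt_pos.2 hd)
  field_simp
  linear_combination p1 * hS2

theorem cofactor_axis (p1 p2 p3 m2 m3 x : ℝ) :
    cofactor p1 p2 p3 m2 m3 x 0
      = p1 + 2 * p2 * (x ^ 2 / 2) + 3 * p3 * (x ^ 2 / 2) ^ 2 := by
  unfold cofactor
  ring

/-- If `p₁` changes sign from plus to minus at `s`, while `p₂` and `m₁` are positive there, a pair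
of centres branches off from the origin along the first axis. Near the origin `∂F/∂y` vanishes
only for `y = 0`, so that only the equation `p₁ + 2 p₂ J + 3 p₃ J² = 0` for `J = x² / 2`
remains. -/
theorem isPitchfork_planar {k p1 p2 p3 m1 m2 m3 : ℝ → ℝ} {s : ℝ}
    (c1 : Continuous p1) (c2 : Continuous p2) (c3 : Continuous p3)
    (d1 : Continuous m1) (d2 : Continuous m2) (d3 : Continuous m3)
    (h0 : p1 s = 0) (hl : ∀ᶠ t in 𝓝 s, t < s → 0 < p1 t) (hr : ∀ᶠ t in 𝓝 s, s < t → p1 t < 0)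
    (hp2 : 0 < p2 s) (hm1 : 0 < m1 s) :
    IsPitchfork (fun t => planar (k t) (p1 t) (p2 t) (p3 t) (m1 t) (m2 t) (m3 t)) (1, 0) s := by
  set R : ℝ → ℝ := fun t => smallRoot (p1 t) (p2 t) (p3 t) with hR
  set a : ℝ → ℝ := fun t => √(2 * R t) with ha
  have hsq : √(p2 s ^ 2 - 3 * p1 s * p3 s) = p2 s := by
    rw [h0]
    simp [Real.sqrt_sq hp2.le]
  have hRc : ContinuousAt R s := by
    simp only [hR, smallRoot]
    refine ContinuousAt.div (by fun_prop) (by fun_prop) ?_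
    rw [hsq]
    positivity
  have hR0 : R s = 0 := by simp [hR, smallRoot, h0]
  have hac : ContinuousAt a s := by
    simp only [ha]
    exact (hRc.const_mul 2).sqrt
  have ha0 : a s = 0 := by simp [ha, hR0]
  have e1 : ∀ᶠ z : ℝ × ℝ × ℝ in 𝓝 (s, 0),
      0 < cofactor (m1 z.1) (m2 z.1) (m3 z.1) (p2 z.1) (p3 z.1) z.2.2 z.2.1 := by
    refine ContinuousAt.eventually_lt continuousAt_const ?_ ?_
    · unfold cofactor
      fun_prop
    · simpa [cofactor] using hm1
  have e2 : ∀ᶠ z : ℝ × ℝ × ℝ in 𝓝 (s, 0),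
      0 < 2 * p2 z.1 + 3 * p3 z.1 * (z.2.1 ^ 2 / 2 + R z.1) := by
    refine ContinuousAt.eventually_lt continuousAt_const ?_ ?_
    · have : ContinuousAt (fun z : ℝ × ℝ × ℝ => R z.1) (s, 0) :=
        ContinuousAt.comp_of_eq (f := fun z : ℝ × ℝ × ℝ => z.1) hRc continuousAt_fst rfl
      fun_prop
    · simpa [hR0] using hp2
  have e3 : ∀ᶠ t in 𝓝 s, 0 < p2 t := continuousAt_const.eventually_lt c2.continuousAt hp2
  have e4 : ∀ᶠ t in 𝓝 s, 0 < p2 t ^ 2 - 3 * p1 t * p3 t := by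
    refine ContinuousAt.eventually_lt continuousAt_const (by fun_prop) ?_
    rw [h0]
    simpa using pow_pos hp2 2
  have e5 : ∀ᶠ t in 𝓝 s, 0 < cofactor (m1 t) (m2 t) (m3 t) (p2 t) (p3 t) 0 (a t) := by
    refine ContinuousAt.eventually_lt continuousAt_const ?_ ?_
    · unfold cofactor
      fun_prop
    · simpa [cofactor, ha0] using hm1
  have e6 : ∀ᶠ t in 𝓝 s, 0 < 2 * p2 t + 3 * p3 t * (a t) ^ 2 := by
    refine ContinuousAt.eventually_lt continuousAt_const (by fun_prop) ?_
    simpa [ha0] using hp2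
  have e7 : ∀ᶠ t in 𝓝 s, 0 < m1 t := continuousAt_const.eventually_lt d1.continuousAt hm1
  obtain ⟨r, hr0, hz⟩ := Metric.eventually_nhds_iff.1 (e1.and e2)
  obtain ⟨η, hη0, ht⟩ := Metric.eventually_nhds_iff.1
    (hl.and (hr.and (e3.and (e4.and (e5.and (e6.and e7))))))
  have key : ∀ t, dist t s < η → dist t s < r → ∀ p ∈ Metric.ball (0 : ℝ × ℝ) r,
      (IsEquilibrium (planar (k t) (p1 t) (p2 t) (p3 t) (m1 t) (m2 t) (m3 t)) p ↔
        p.2 = 0 ∧ (p.1 = 0 ∨ p.1 ^ 2 / 2 = R t)) := by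
    rintro t h1 h2 ⟨x, y⟩ hp
    obtain ⟨-, -, g3, g4, -⟩ := ht h1
    have hd : dist (t, (x, y)) (s, (0 : ℝ × ℝ)) < r := by
      rw [Prod.dist_eq]
      exact max_lt h2 hp
    obtain ⟨f1, f2⟩ := hz hd
    simp only at f1 f2 ⊢
    rw [isEquilibrium_planar]
    simp only [mul_eq_zero, f1.ne', or_false]
    have hroot : p1 t + 2 * p2 t * R t + 3 * p3 t * R t ^ 2 = 0 := smallRoot_spec g3 g4
    constructor
    · rintro ⟨hx, rfl⟩
      refine ⟨rfl, hx.imp_right fun hx => ?_⟩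
      rw [cofactor_axis] at hx
      have : (x ^ 2 / 2 - R t) * (2 * p2 t + 3 * p3 t * (x ^ 2 / 2 + R t)) = 0 := by
        linear_combination hx - hroot
      exact sub_eq_zero.1 ((mul_eq_zero.1 this).resolve_right f2.ne')
    · rintro ⟨rfl, hx⟩
      refine ⟨hx.imp_right fun hx => ?_, rfl⟩
      rw [cofactor_axis, hx]
      exact hroot
  have hdist : ∀ {t}, t ∈ Ioo (s - min η r) (s + min η r) → dist t s < η ∧ dist t s < r := by
    intro t h
    rw [Real.dist_eq, ← lt_min_iff, abs_lt]
    constructor <;> linarith [h.1, h.2]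
  have hmin : 0 < min η r := lt_min hη0 hr0
  -- the sign of the branch is opposite to the sign of `p₁`
  have hRsign : ∀ t, 0 < p2 t → 0 < p2 t ^ 2 - 3 * p1 t * p3 t →
      (0 ≤ p1 t → R t ≤ 0) ∧ (p1 t < 0 → 0 < R t) := by
    intro t g3 g4
    have hpos : 0 < p2 t + √(p2 t ^ 2 - 3 * p1 t * p3 t) := add_pos g3 (Real.sqrt_pos.2 g4)
    exact ⟨fun h => div_nonpos_of_nonpos_of_nonneg (by linarith) hpos.le,
      fun h => div_pos (by linarith) hpos⟩
  refine ⟨r, hr0, min η r, hmin, a, fun t h => ?_, fun t h p hp => ?_, fun t h => ?_, ?_⟩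
  · obtain ⟨i1, -⟩ := hdist ⟨h.1, h.2.trans (by linarith)⟩
    obtain ⟨g1, -, -, -, -, -, g7⟩ := ht i1
    exact (isCenter_planar_zero _ _ _ _ _ _ _).2 (mul_pos (g1 h.2) g7)
  · obtain ⟨i1, i2⟩ := hdist ⟨h.1, h.2.trans_lt (by linarith)⟩
    obtain ⟨g1, -, g3, g4, -⟩ := ht i1
    rw [key t i1 i2 p hp]
    have hp1 : 0 ≤ p1 t := by
      rcases h.2.lt_or_eq with h' | h'
      · exact (g1 h').le
      · rw [h', h0]
    have hRt := (hRsign t g3 g4).1 hp1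
    constructor
    · rintro ⟨hy, hx⟩
      refine Prod.ext ?_ hy
      rcases hx with hx | hx
      · exact hx
      · exact pow_eq_zero_iff two_ne_zero |>.1 (by nlinarith [sq_nonneg p.1])
    · rintro rfl
      exact ⟨rfl, Or.inl rfl⟩
  · obtain ⟨i1, i2⟩ := hdist ⟨by linarith [h.1], h.2⟩
    obtain ⟨-, g2, g3, g4, g5, g6, g7⟩ := ht i1
    have hRt := (hRsign t g3 g4).2 (g2 h.1)
    have hat : 0 < a t := Real.sqrt_pos.2 (by linarith)
    have hat2 : a t ^ 2 = 2 * R t := Real.sq_sqrt (by linarith)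
    have hroot : p1 t + 2 * p2 t * R t + 3 * p3 t * R t ^ 2 = 0 := smallRoot_spec g3 g4
    have hcen : ∀ x : ℝ, x ^ 2 = a t ^ 2 →
        IsCenter (planar (k t) (p1 t) (p2 t) (p3 t) (m1 t) (m2 t) (m3 t)) (x, 0) := by
      intro x hx
      have hco : cofactor (p1 t) (p2 t) (p3 t) (m2 t) (m3 t) x 0 = 0 := by
        rw [cofactor_axis, hx, hat2]
        linear_combination hroot
      rw [isCenter_iff, isEquilibrium_planar, trace_linearisation_planar,
        det_linearisation_planar_axis]
      refine ⟨⟨?_, ?_⟩, rfl, ?_⟩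
      · simp [hco]
      · simp
      · have : cofactor (m1 t) (m2 t) (m3 t) (p2 t) (p3 t) 0 x
            = cofactor (m1 t) (m2 t) (m3 t) (p2 t) (p3 t) 0 (a t) := by
          simp only [cofactor, hx]
        rw [hco, hx, this]
        have := pow_pos hat 2
        positivity
    refine ⟨(isSaddle_planar_zero _ _ _ _ _ _ _).2 (mul_neg_of_neg_of_pos (g2 h.1) g7), hat,
      ?_, ?_, fun p hp => ?_⟩
    · simpa using hcen (a t) rfl
    · simpa using hcen (-a t) (by ring)
    · rw [key t i1 i2 p hp]
      have : p.1 ^ 2 / 2 = R t ↔ p.1 = a t ∨ p.1 = -a t := by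
        rw [← sq_eq_sq_iff_eq_or_eq_neg, hat2]
        constructor <;> intro h <;> linarith
      rw [this]
      simp only [Prod.ext_iff]
      simp
      tauto
  · have := hac.tendsto.mono_left (nhdsWithin_le_nhds (s := Ioi s))
    rwa [ha0] at this

/-- The mirror image of `isPitchfork_planar` under `negSwap`: `m₁` changes sign from minus to
plus, and a pair of centres branches off along the second axis. -/
theorem isPitchfork_planar_snd {k p1 p2 p3 m1 m2 m3 : ℝ → ℝ} {s : ℝ}
    (c1 : Continuous p1) (c2 : Continuous p2) (c3 : Continuous p3)
    (d1 : Continuous m1) (d2 : Continuous m2) (d3 : Continuous m3)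
    (h0 : m1 s = 0) (hl : ∀ᶠ t in 𝓝 s, t < s → m1 t < 0) (hr : ∀ᶠ t in 𝓝 s, s < t → 0 < m1 t)
    (hm2 : m2 s < 0) (hp1 : p1 s < 0) :
    IsPitchfork (fun t => planar (k t) (p1 t) (p2 t) (p3 t) (m1 t) (m2 t) (m3 t)) (0, 1) s := by
  have h := (isPitchfork_planar (k := fun t => -k t) (p1 := fun t => -m1 t) (p2 := fun t => -m2 t)
    (p3 := fun t => -m3 t) (m1 := fun t => -p1 t) (m2 := fun t => -p2 t) (m3 := fun t => -p3 t)
    (s := s) (by fun_prop) (by fun_prop) (by fun_prop) (by fun_prop) (by fun_prop) (by fun_prop)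
    (by simp [h0]) (hl.mono fun t h h' => by linarith [h h'])
    (hr.mono fun t h h' => by linarith [h h']) (by linarith) (by linarith)).negSwap
  simpa only [negSwap_planar, neg_neg, Prod.swap_prod_mk] using h

/-! ### Hamiltonians with one harmonic of the phase -/

/-- The polynomial `a₀ + a₁ x + a₂ x² + a₃ x³`. -/
def cubic (a0 a1 a2 a3 x : ℝ) : ℝ := a0 + a1 * x + a2 * x ^ 2 + a3 * x ^ 3

theorem hasDerivAt_cubic (a0 a1 a2 a3 x : ℝ) :
    HasDerivAt (cubic a0 a1 a2 a3) (a1 + 2 * a2 * x + 3 * a3 * x ^ 2) x :=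
  (((((hasDerivAt_id' x).const_mul a1).const_add a0).add ((hasDerivAt_pow 2 x).const_mul a2)).add
    ((hasDerivAt_pow 3 x).const_mul a3)).congr_deriv (by simp; ring)

theorem hasDerivAt_quadratic (a1 a2 a3 x : ℝ) :
    HasDerivAt (fun x => a1 + 2 * a2 * x + 3 * a3 * x ^ 2) (2 * (a2 + 3 * a3 * x)) x :=
  ((((hasDerivAt_id' x).const_mul (2 * a2)).const_add a1).add
    ((hasDerivAt_pow 2 x).const_mul (3 * a3))).congr_deriv (by simp; ring)

/-- The function of `(J, ψ)` that is affine in `cos 2ψ`, equal to `P J` on `ψ = 0` and to `M J` on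
`ψ = π / 2`. -/
noncomputable def phaseHam (P M : ℝ → ℝ) (q : ℝ × ℝ) : ℝ :=
  (P q.1 + M q.1) / 2 + (P q.1 - M q.1) / 2 * Real.cos (2 * q.2)

theorem hasDerivAt_cos_two_mul (x : ℝ) :
    HasDerivAt (fun t => Real.cos (2 * t)) (-2 * Real.sin (2 * x)) x :=
  (((hasDerivAt_id' x).const_mul 2).cos).congr_deriv (by ring)

theorem hasDerivAt_sin_two_mul (x : ℝ) :
    HasDerivAt (fun t => Real.sin (2 * t)) (2 * Real.cos (2 * x)) x :=
  (((hasDerivAt_id' x).const_mul 2).sin).congr_deriv (by ring)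

theorem pd1_phaseHam {P M P' M' : ℝ → ℝ} (hP : ∀ x, HasDerivAt P (P' x) x)
    (hM : ∀ x, HasDerivAt M (M' x) x) : pd1 (phaseHam P M) = phaseHam P' M' := by
  funext q
  exact ((((hP q.1).add (hM q.1)).div_const 2).add
    ((((hP q.1).sub (hM q.1)).div_const 2).mul_const (Real.cos (2 * q.2)))).deriv

theorem pd2_phaseHam (P M : ℝ → ℝ) :
    pd2 (phaseHam P M) = fun q => -(P q.1 - M q.1) * Real.sin (2 * q.2) := by
  funext q
  refine ((((hasDerivAt_cos_two_mul q.2).const_mul ((P q.1 - M q.1) / 2)).const_add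
    ((P q.1 + M q.1) / 2)).congr_deriv ?_).deriv
  ring

/-- Where `P < M`, the critical points lie on the symmetry axes `sin 2ψ = 0`. On them the value of
`cos 2ψ` reduces the Hamiltonian to `P` or to `M`, and convexity of `P` and concavity of `M` make
it elliptic. -/
theorem isCenter_phaseHam {P M P' M' P'' M'' : ℝ → ℝ} (hP : ∀ x, HasDerivAt P (P' x) x)
    (hM : ∀ x, HasDerivAt M (M' x) x) (hP' : ∀ x, HasDerivAt P' (P'' x) x)
    (hM' : ∀ x, HasDerivAt M' (M'' x) x) {q : ℝ × ℝ} (hlt : P q.1 < M q.1) (hp : 0 < P'' q.1)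
    (hm : M'' q.1 < 0) (h : IsEquilibrium (phaseHam P M) q) :
    IsCenter (phaseHam P M) q ∧ (Real.sin q.2 = 0 ∨ Real.cos q.2 = 0) := by
  have h' := h
  rw [isEquilibrium_iff, pd1_phaseHam hP hM, pd2_phaseHam] at h'
  have hs : Real.sin (2 * q.2) = 0 :=
    (mul_eq_zero.1 h'.2).resolve_left (by linarith)
  have h12 : pd2 (pd1 (phaseHam P M)) q = 0 := by
    rw [pd1_phaseHam hP hM, pd2_phaseHam]
    simp [hs]
  have h21 : pd1 (pd2 (phaseHam P M)) q = 0 := by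
    rw [pd2_phaseHam]
    simp [pd1, hs]
  have h11 : pd1 (pd1 (phaseHam P M)) q = phaseHam P'' M'' q := by
    rw [pd1_phaseHam hP hM, pd1_phaseHam hP' hM']
  have h22 : pd2 (pd2 (phaseHam P M)) q = -(P q.1 - M q.1) * (2 * Real.cos (2 * q.2)) := by
    rw [pd2_phaseHam]
    exact ((hasDerivAt_sin_two_mul q.2).const_mul (-(P q.1 - M q.1))).deriv
  refine ⟨?_, ?_⟩
  · rw [isCenter_iff, trace_linearisation, det_linearisation, h12, h21, h11, h22]
    refine ⟨h, by simp, ?_⟩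
    unfold phaseHam
    have hc : Real.cos (2 * q.2) = 1 ∨ Real.cos (2 * q.2) = -1 := by
      exact Real.sin_eq_zero_iff_cos_eq.1 hs
    rcases hc with hc | hc <;> rw [hc]
    · nlinarith
    · nlinarith
  · rw [Real.sin_two_mul] at hs
    simpa using hs

/-! ### The resonant normal form -/

section Coefficients

variable (c : Coeffs) (n δ E : ℝ)

/-- The coefficient of `E² J` in `𝒜₂`. -/
noncomputable def kA1 : ℝ :=
  68 / 3 * c.A ^ 2 - 68 / 3 * c.A * c.B + 17 / 3 * c.B ^ 2 - 32 * c.A * c.C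
    + 16 * c.B * c.C - 36 * c.C ^ 2 + 3 / 2 * c.v24 - 15 / 2 * c.v06

/-- The coefficient of `E J²` in `𝒜₂`. -/
noncomputable def kA2 : ℝ :=
  68 / 3 * c.A * c.B - 68 / 3 * c.A ^ 2 - 17 / 3 * c.B ^ 2 + 32 * c.A * c.C
    - 48 * c.B * c.C + 36 * c.C ^ 2 + 3 / 2 * c.v42 - 3 * c.v24 + 15 / 2 * c.v06

/-- The coefficient of `J³` in `𝒜₂`. -/
noncomputable def kA3 : ℝ :=
  32 * c.B * c.C + 5 / 2 * c.v60 - 136 / 9 * c.A * c.B - 3 / 2 * c.v42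
    + 3 / 2 * c.v24 - 5 / 2 * c.v06

/-- The coefficient of `E² J` in `ℬ₂`. -/
noncomputable def kB1 : ℝ :=
  c.v24 - 32 * c.C ^ 2 - 40 / 3 * c.A * c.C + 20 / 3 * c.B * c.C

/-- The coefficient of `J³` in `ℬ₂`. -/
noncomputable def kB3 : ℝ := 40 / 3 * c.B * c.C - c.v42 + c.v24

/-- The part of the Hamiltonian independent of `J`. The phase independent part is
`a₀ + a₁ J + a₂ J² + a₃ J³` and the coefficient of `cos 2ψ` is `J (E - J) (b₀ + b₁ J)`. The terms of
second order carry the factor `n = N - 1`, which treats both truncations at once. -/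
noncomputable def a0 : ℝ :=
  E + (2 * c.A - c.B) * E ^ 2
    + n * (1 / 9 * (68 * c.A * c.B - 68 * c.A ^ 2 - 17 * c.B ^ 2 + 45 / 2 * c.v06) * E ^ 3)

/-- The coefficient of `J` in the phase independent part of the Hamiltonian. -/
noncomputable def a1 : ℝ :=
  δ + (-4 * c.A + 2 * c.B + 8 * c.C) * E + n * (kA1 c * E ^ 2 - 8 * c.C * δ * E)

/-- The coefficient of `J²` in the phase independent part of the Hamiltonian. -/
noncomputable def a2 : ℝ :=
  4 * (c.A - 2 * c.C) + n * (kA2 c * E + 2 * (4 * c.C - 2 * c.A - c.B) * δ)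

/-- The coefficient of `J³` in the phase independent part of the Hamiltonian. -/
noncomputable def a3 : ℝ := n * kA3 c

/-- The constant term of the cofactor `b₀ + b₁ J` of `J (E - J) cos 2ψ` in the Hamiltonian. -/
noncomputable def b0 : ℝ := 4 * c.C + n * (kB1 c * E - 4 * c.C * δ)

/-- The linear coefficient of the cofactor `b₀ + b₁ J` of `J (E - J) cos 2ψ` in the Hamiltonian. -/
noncomputable def b1 : ℝ := -(n * kB3 c)

/-- The coefficient of `J` in the Hamiltonian on the phase `ψ = 0`; also the slope at `J = 0`. -/
noncomputable def incl1 : ℝ := a1 c n δ E + E * b0 c n δ E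

/-- The coefficient of `J²` in the Hamiltonian on the phase `ψ = 0`. -/
noncomputable def incl2 : ℝ := a2 c n δ E + (E * b1 c n - b0 c n δ E)

/-- The coefficient of `J³` in the Hamiltonian on the phase `ψ = 0`. -/
noncomputable def incl3 : ℝ := a3 c n - b1 c n

/-- The coefficient of `J` in the Hamiltonian on the phase `ψ = π / 2`; also the slope at `J = 0`. -/
noncomputable def loop1 : ℝ := a1 c n δ E - E * b0 c n δ E

/-- The coefficient of `J²` in the Hamiltonian on the phase `ψ = π / 2`. -/
noncomputable def loop2 : ℝ := a2 c n δ E - (E * b1 c n - b0 c n δ E)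

/-- The coefficient of `J³` in the Hamiltonian on the phase `ψ = π / 2`. -/
noncomputable def loop3 : ℝ := a3 c n + b1 c n

/-- The Hamiltonian on the phase `ψ = 0`. -/
noncomputable def inclPoly : ℝ → ℝ :=
  cubic (a0 c n E) (incl1 c n δ E) (incl2 c n δ E) (incl3 c n)

/-- The Hamiltonian on the phase `ψ = π / 2`. -/
noncomputable def loopPoly : ℝ → ℝ :=
  cubic (a0 c n E) (loop1 c n δ E) (loop2 c n δ E) (loop3 c n)

/-- The derivative of the inclined profile at the mode `J = E`. -/
noncomputable def inclEnd : ℝ := incl1 c n δ E + 2 * incl2 c n δ E * E + 3 * incl3 c n * E ^ 2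

/-- The derivative of the loop profile at the mode `J = E`. -/
noncomputable def loopEnd : ℝ := loop1 c n δ E + 2 * loop2 c n δ E * E + 3 * loop3 c n * E ^ 2

end Coefficients

section Charts

variable {c : Coeffs} {N : ℕ}

theorem ham_eq (hN : N = 1 ∨ N = 2) (δ E : ℝ) :
    ham c N δ E = phaseHam (inclPoly c (N - 1) δ E) (loopPoly c (N - 1) δ E) := by
  funext q
  simp only [ham, phaseHam, inclPoly, loopPoly, cubic, incl1, incl2, incl3, loop1, loop2, loop3,
    a0, a1, a2, a3, b0, b1, kA1, kA2, kA3, kB1, kB3]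
  rcases hN with rfl | rfl
  · simp [polyA, polyB]
    ring
  · simp [Finset.sum_Icc_succ_top, polyA, polyB]
    ring

/-- In polar coordinates, `r² cos 2φ = x² - y²`; at the origin both sides vanish, whatever the value
of the argument. -/
theorem radius_mul_cos_two_arg (x y : ℝ) :
    (x ^ 2 + y ^ 2) * Real.cos (2 * Complex.arg ⟨x, y⟩) = x ^ 2 - y ^ 2 := by
  by_cases h : (⟨x, y⟩ : ℂ) = 0
  · have hx : x = 0 := congrArg Complex.re h
    have hy : y = 0 := congrArg Complex.im h
    simp [hx, hy]
  · have h1 : ‖(⟨x, y⟩ : ℂ)‖ * Real.cos (Complex.arg ⟨x, y⟩) = x := Complex.norm_mul_cos_arg _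
    have h2 : ‖(⟨x, y⟩ : ℂ)‖ ^ 2 = x ^ 2 + y ^ 2 := by
      rw [← Complex.normSq_eq_norm_sq, Complex.normSq_mk]
      ring
    rw [Real.cos_two_mul]
    linear_combination 2 * (‖(⟨x, y⟩ : ℂ)‖ * Real.cos (Complex.arg ⟨x, y⟩) + x) * h1
      - 2 * Real.cos (Complex.arg ⟨x, y⟩) ^ 2 * h2

/-- In the chart of `J = 0`, the coefficients of the normal form are those of the two profiles. -/
theorem chart1_eq (hN : N = 1 ∨ N = 2) (δ E : ℝ) :
    chart1 c N δ E = planar (a0 c (N - 1) E)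
      (incl1 c (N - 1) δ E) (incl2 c (N - 1) δ E) (incl3 c (N - 1))
      (loop1 c (N - 1) δ E) (loop2 c (N - 1) δ E) (loop3 c (N - 1)) := by
  funext q
  obtain ⟨x, y⟩ := q
  have h := radius_mul_cos_two_arg x y
  simp only [chart1, ham_eq hN, phaseHam, inclPoly, loopPoly, cubic, planar, incl1, incl2, incl3,
    loop1, loop2, loop3]
  generalize Real.cos (2 * Complex.arg ⟨x, y⟩) = C at h
  generalize a1 c (N - 1) δ E = A1
  generalize a2 c (N - 1) δ E = A2
  generalize b0 c (N - 1) δ E = B0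
  linear_combination (1 / 2 * (E - (x ^ 2 + y ^ 2) / 2)
    * (B0 + b1 c (N - 1) * ((x ^ 2 + y ^ 2) / 2))) * h

/-- In the chart of `J = E`, the coefficients are those of the two profiles expanded in `E - J`. -/
theorem chart2_eq (hN : N = 1 ∨ N = 2) (δ E : ℝ) :
    chart2 c N δ E = planar (inclPoly c (N - 1) δ E E)
      (-inclEnd c (N - 1) δ E) (incl2 c (N - 1) δ E + 3 * incl3 c (N - 1) * E) (-incl3 c (N - 1))
      (-loopEnd c (N - 1) δ E) (loop2 c (N - 1) δ E + 3 * loop3 c (N - 1) * E)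
      (-loop3 c (N - 1)) := by
  funext q
  obtain ⟨x, y⟩ := q
  have h := radius_mul_cos_two_arg x y
  simp only [chart2, ham_eq hN, phaseHam, inclPoly, loopPoly, cubic, planar, inclEnd, loopEnd,
    incl1, incl2, incl3, loop1, loop2, loop3]
  generalize Real.cos (2 * Complex.arg ⟨x, y⟩) = C at h
  generalize a1 c (N - 1) δ E = A1
  generalize a2 c (N - 1) δ E = A2
  generalize b0 c (N - 1) δ E = B0
  linear_combination (1 / 2 * (E - (x ^ 2 + y ^ 2) / 2)
    * (B0 + b1 c (N - 1) * (E - (x ^ 2 + y ^ 2) / 2))) * h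

end Charts

/-! ### Heteroclinic orbits -/

/-- A scalar equation `θ' = v(θ)` with `v` continuous, positive and bounded has a global solution
running from `-∞` to `∞`: the inverse of the travel time `∫ dθ / v(θ)`. -/
theorem exists_global_solution {v : ℝ → ℝ} (hv : Continuous v) (hpos : ∀ x, 0 < v x) {V : ℝ}
    (hV : ∀ x, v x ≤ V) :
    ∃ θ : ℝ → ℝ, (∀ t, HasDerivAt θ (v (θ t)) t) ∧ Tendsto θ atBot atBot ∧
      Tendsto θ atTop atTop := by
  have hV0 : 0 < V := (hpos 0).trans_le (hV 0)
  have hinv : Continuous fun x => (v x)⁻¹ := hv.inv₀ fun x => (hpos x).ne'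
  set T : ℝ → ℝ := fun x => ∫ s in (0 : ℝ)..x, (v s)⁻¹ with hT
  have hTd : ∀ x, HasDerivAt T (v x)⁻¹ x := fun x =>
    intervalIntegral.integral_hasDerivAt_right (hinv.intervalIntegrable _ _)
      hinv.stronglyMeasurable.stronglyMeasurableAtFilter hinv.continuousAt
  have hTc : Continuous T := continuous_iff_continuousAt.2 fun x => (hTd x).continuousAt
  have hmono : StrictMono T := strictMono_of_deriv_pos fun x => by
    rw [(hTd x).deriv]
    exact inv_pos.2 (hpos x)
  -- `T x - x / V` is monotone, so that `T` grows at least linearly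
  have hmono' : Monotone fun x => T x - V⁻¹ * x := by
    refine monotone_of_deriv_nonneg
      (fun x => ((hTd x).sub ((hasDerivAt_id' x).const_mul V⁻¹)).differentiableAt) fun x => ?_
    have := ((hTd x).sub ((hasDerivAt_id' x).const_mul V⁻¹)).deriv
    have h2 : V⁻¹ ≤ (v x)⁻¹ := inv_anti₀ (hpos x) (hV x)
    calc (0 : ℝ) ≤ (v x)⁻¹ - V⁻¹ * 1 := by linarith
      _ = _ := this.symm
  have hT0 : T 0 = 0 := by simp [hT]
  have htop : Tendsto T atTop atTop := by
    refine tendsto_atTop_mono' _ ?_ (tendsto_id.const_mul_atTop (inv_pos.2 hV0))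
    filter_upwards [eventually_ge_atTop 0] with x hx
    have := hmono' hx
    simp only [hT0] at this
    simp only [id]
    linarith
  have hbot : Tendsto T atBot atBot := by
    refine tendsto_atBot_mono' _ ?_ (tendsto_id.const_mul_atBot (inv_pos.2 hV0))
    filter_upwards [eventually_le_atBot 0] with x hx
    have := hmono' hx
    simp only [hT0] at this
    simp only [id]
    linarith
  set e : ℝ ≃o ℝ := hmono.orderIsoOfSurjective T (hTc.surjective htop hbot) with he
  have hTe : ∀ t, T (e.symm t) = t := fun t => e.apply_symm_apply t
  refine ⟨e.symm, fun t => ?_, e.symm.tendsto_atBot, e.symm.tendsto_atTop⟩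
  have := HasDerivAt.of_local_left_inverse (f := T) (g := e.symm) (a := t)
    e.symm.continuous.continuousAt (hTd (e.symm t)) (inv_pos.2 (hpos _)).ne'
    (Eventually.of_forall hTe)
  rwa [inv_inv] at this

/-- The equation `u' = u (E - u) w(u)` with `w > 0` has a solution running from `0` to `E`, because
`θ = log (u / (E - u))` obeys an equation with bounded right-hand side. -/
theorem exists_connecting_solution {E : ℝ} (hE : 0 < E) {w : ℝ → ℝ}
    (hw : ContinuousOn w (Icc 0 E)) (hpos : ∀ x ∈ Icc 0 E, 0 < w x) :
    ∃ u : ℝ → ℝ, (∀ t, u t ∈ Ioo 0 E ∧ HasDerivAt u (u t * (E - u t) * w (u t)) t) ∧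
      Tendsto u atBot (𝓝 0) ∧ Tendsto u atTop (𝓝 E) := by
  have hmem : ∀ x, E * Real.sigmoid x ∈ Ioo 0 E := fun x =>
    ⟨mul_pos hE (Real.sigmoid_pos x), mul_lt_of_lt_one_right hE (Real.sigmoid_lt_one x)⟩
  obtain ⟨x₀, -, hx₀⟩ := isCompact_Icc.exists_isMaxOn (nonempty_Icc.2 hE.le) hw
  have hcont : Continuous fun x => E * w (E * Real.sigmoid x) :=
    continuous_const.mul (hw.comp_continuous
      (continuous_const.mul continuous_sigmoid) fun x => Ioo_subset_Icc_self (hmem x))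
  obtain ⟨θ, hθ, hbot, htop⟩ := exists_global_solution hcont
    (fun x => mul_pos hE (hpos _ (Ioo_subset_Icc_self (hmem x))))
    (V := E * w x₀) (fun x => mul_le_mul_of_nonneg_left (hx₀ (Ioo_subset_Icc_self (hmem x))) hE.le)
  refine ⟨fun t => E * Real.sigmoid (θ t), fun t => ⟨hmem _, ?_⟩, ?_, ?_⟩
  · refine (((Real.hasDerivAt_sigmoid (θ t)).comp t (hθ t)).const_mul E).congr_deriv ?_
    ring
  · simpa using (Real.tendsto_sigmoid_atBot.comp hbot).const_mul E
  · simpa using (Real.tendsto_sigmoid_atTop.comp htop).const_mul E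

theorem hamField_phaseHam {P M P' M' : ℝ → ℝ} (hP : ∀ x, HasDerivAt P (P' x) x)
    (hM : ∀ x, HasDerivAt M (M' x) x) (q : ℝ × ℝ) :
    hamField (phaseHam P M) q
      = (-(P q.1 - M q.1) * Real.sin (2 * q.2), -phaseHam P' M' q) := by
  rw [hamField, pd1_phaseHam hP hM, pd2_phaseHam]

/-- The Hamiltonian is constant along a connecting orbit. -/
theorem eq_of_connecting_orbit {P M P' M' : ℝ → ℝ} (hP : ∀ x, HasDerivAt P (P' x) x)
    (hM : ∀ x, HasDerivAt M (M' x) x) {E : ℝ} (h0 : P 0 = M 0) (hE : P E = M E)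
    {γ : ℝ → ℝ × ℝ} (hγ : ∀ t, HasDerivAt γ (hamField (phaseHam P M) (γ t)) t)
    (hbot : Tendsto (fun t => (γ t).1) atBot (𝓝 0))
    (htop : Tendsto (fun t => (γ t).1) atTop (𝓝 E)) : P 0 = P E := by
  have hγ1 : ∀ t, HasDerivAt (fun t => (γ t).1)
      (-(P (γ t).1 - M (γ t).1) * Real.sin (2 * (γ t).2)) t := fun t => by
    have := (hγ t).fst
    rwa [hamField_phaseHam hP hM] at this
  have hγ2 : ∀ t, HasDerivAt (fun t => (γ t).2) (-phaseHam P' M' (γ t)) t := fun t => by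
    have := (hγ t).snd
    rwa [hamField_phaseHam hP hM] at this
  have hK : ∀ t, HasDerivAt (fun t => phaseHam P M (γ t)) 0 t := by
    intro t
    have h1 := (hP (γ t).1).comp t (hγ1 t)
    have h2 := (hM (γ t).1).comp t (hγ1 t)
    have h3 := (hasDerivAt_cos_two_mul (γ t).2).comp t (hγ2 t)
    refine (((h1.add h2).div_const 2).add (((h1.sub h2).div_const 2).mul h3)).congr_deriv ?_
    simp only [phaseHam, Function.comp, Pi.sub_apply]
    ring
  have hconst : ∀ t, phaseHam P M (γ t) = phaseHam P M (γ 0) := fun t =>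
    is_const_of_deriv_eq_zero (fun t => (hK t).differentiableAt) (fun t => (hK t).deriv) t 0
  -- where `P = M`, the bounded factor `cos 2ψ` drops out of the limit
  have hlim : ∀ {l : Filter ℝ} {x : ℝ}, P x = M x → Tendsto (fun t => (γ t).1) l (𝓝 x) →
      Tendsto (fun t => phaseHam P M (γ t)) l (𝓝 (P x)) := by
    intro l x hx hl
    have h1 := (hP x).continuousAt.tendsto.comp hl
    have h2 := (hM x).continuousAt.tendsto.comp hl
    have h3 : Tendsto (fun t => (P (γ t).1 - M (γ t).1) / 2 * Real.cos (2 * (γ t).2)) l (𝓝 0) := by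
      refine Tendsto.zero_mul_isBoundedUnder_le ?_ ?_
      · simpa [Function.comp_def, hx] using (h1.sub h2).div_const 2
      · exact isBoundedUnder_of ⟨1, fun t => by simpa using Real.abs_cos_le_one _⟩
    have h4 := ((h1.add h2).div_const 2).add h3
    simpa [phaseHam, Function.comp_def, ← hx] using h4
  have e1 := hlim h0 hbot
  have e2 := hlim hE htop
  simp only [hconst] at e1 e2
  exact (tendsto_nhds_unique e1 tendsto_const_nhds).trans
    (tendsto_nhds_unique tendsto_const_nhds e2)

/-- Suppose that `(P + M) / 2 = k - x (E - x) Q` and `(P - M) / 2 = x (E - x) S` with `S < 0` and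
`|Q| < |S|`. The level set through the two ends is `cos 2ψ = Q / S`, and along it
`J' = J (E - J) w(J)` with `w = -2 S sin 2ψ > 0`. -/
theorem exists_connecting_orbit {P M P' M' Q S Q' S' : ℝ → ℝ} {k E : ℝ} (hE : 0 < E)
    (hP : ∀ x, HasDerivAt P (P' x) x) (hM : ∀ x, HasDerivAt M (M' x) x)
    (hQ : ∀ x, HasDerivAt Q (Q' x) x) (hS : ∀ x, HasDerivAt S (S' x) x)
    (hPQ : ∀ x, P x = k + x * (E - x) * (S x - Q x))
    (hMQ : ∀ x, M x = k + x * (E - x) * (-S x - Q x))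
    (hneg : ∀ x ∈ Icc 0 E, S x < Q x) (hneg' : ∀ x ∈ Icc 0 E, S x < -Q x) :
    ∃ γ : ℝ → ℝ × ℝ, (∀ t, HasDerivAt γ (hamField (phaseHam P M) (γ t)) t ∧ (γ t).1 ∈ Ioo 0 E) ∧
      Tendsto (fun t => (γ t).1) atBot (𝓝 0) ∧ Tendsto (fun t => (γ t).1) atTop (𝓝 E) := by
  have hS0 : ∀ x ∈ Icc 0 E, S x < 0 := fun x hx => by linarith [hneg x hx, hneg' x hx]
  have hlt : ∀ x ∈ Icc 0 E, Q x / S x < 1 := fun x hx => by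
    rw [div_lt_one_of_neg (hS0 x hx)]
    exact hneg x hx
  have hgt : ∀ x ∈ Icc 0 E, -1 < Q x / S x := fun x hx => by
    rw [lt_div_iff_of_neg (hS0 x hx)]
    linarith [hneg' x hx]
  have hsq : ∀ x ∈ Icc 0 E, 0 < 1 - (Q x / S x) ^ 2 := fun x hx => by
    nlinarith [hlt x hx, hgt x hx]
  have hQc : Continuous Q := continuous_iff_continuousAt.2 fun x => (hQ x).continuousAt
  have hSc : Continuous S := continuous_iff_continuousAt.2 fun x => (hS x).continuousAt
  have hwc : ContinuousOn (fun x => -2 * S x * √(1 - (Q x / S x) ^ 2)) (Icc 0 E) := by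
    have : ContinuousOn (fun x => Q x / S x) (Icc 0 E) :=
      hQc.continuousOn.div hSc.continuousOn fun x hx => (hS0 x hx).ne
    fun_prop
  obtain ⟨u, hu, hbot, htop⟩ := exists_connecting_solution hE hwc fun x hx =>
    mul_pos (by linarith [hS0 x hx]) (Real.sqrt_pos.2 (hsq x hx))
  refine ⟨fun t => (u t, Real.arccos (Q (u t) / S (u t)) / 2), fun t => ⟨?_, (hu t).1⟩, hbot, htop⟩
  obtain ⟨hmem, hud⟩ := hu t
  have hmem' := Ioo_subset_Icc_self hmem
  have hSne := (hS0 _ hmem').ne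
  have hPd : P' (u t) = (E - 2 * u t) * (S (u t) - Q (u t))
      + u t * (E - u t) * (S' (u t) - Q' (u t)) := by
    refine (hP (u t)).unique ?_
    have hfun : P = fun x => k + x * (E - x) * (S x - Q x) := funext hPQ
    rw [hfun]
    exact ((((hasDerivAt_id' (u t)).mul ((hasDerivAt_id' (u t)).const_sub E)).mul
      ((hS (u t)).sub (hQ (u t)))).const_add k).congr_deriv (by dsimp; ring)
  have hMd : M' (u t) = (E - 2 * u t) * (-S (u t) - Q (u t))
      + u t * (E - u t) * (-S' (u t) - Q' (u t)) := by
    refine (hM (u t)).unique ?_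
    have hfun : M = fun x => k + x * (E - x) * (-S x - Q x) := funext hMQ
    rw [hfun]
    exact ((((hasDerivAt_id' (u t)).mul ((hasDerivAt_id' (u t)).const_sub E)).mul
      ((hS (u t)).neg.sub (hQ (u t)))).const_add k).congr_deriv (by dsimp; ring)
  rw [hamField_phaseHam hP hM]
  have hcos : Real.cos (2 * (Real.arccos (Q (u t) / S (u t)) / 2)) = Q (u t) / S (u t) := by
    rw [mul_div_cancel₀ _ two_ne_zero, Real.cos_arccos (hgt _ hmem').le (hlt _ hmem').le]
  have hsin : Real.sin (2 * (Real.arccos (Q (u t) / S (u t)) / 2))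
      = √(1 - (Q (u t) / S (u t)) ^ 2) := by
    rw [mul_div_cancel₀ _ two_ne_zero, Real.sin_arccos]
  refine HasDerivAt.prodMk (hud.congr_deriv ?_) ?_
  · simp only [hsin, hPQ, hMQ]
    ring
  · have hr : HasDerivAt (fun t => Q (u t) / S (u t)) _ t :=
      ((hQ (u t)).comp t hud).div ((hS (u t)).comp t hud) hSne
    refine (((Real.hasDerivAt_arccos (hgt _ hmem').ne' (hlt _ hmem').ne).comp t hr).div_const
      2).congr_deriv ?_
    simp only [phaseHam, hcos, hPd, hMd, Function.comp]
    have hq := (Real.sqrt_pos.2 (hsq _ hmem')).ne'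
    generalize √(1 - (Q (u t) / S (u t)) ^ 2) = σ at hq
    field_simp
    ring

/-! ### Threshold curves -/

/-- The root `E` of `δ + m E + α E² + β δ E` that tends to zero with `δ`, for `m > 0`. This form of
the quadratic formula also covers `α = 0`. -/
noncomputable def threshold (m α β δ : ℝ) : ℝ :=
  -2 * δ / (m + β * δ + √((m + β * δ) ^ 2 - 4 * α * δ))

theorem threshold_root {m : ℝ} (hm : 0 < m) (α β : ℝ) :
    ∀ᶠ δ in 𝓝 (0 : ℝ), 0 < m + β * δ ∧
    δ + m * threshold m α β δ + α * threshold m α β δ ^ 2 + β * δ * threshold m α β δ = 0 ∧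
    (δ < 0 → 0 < threshold m α β δ) := by
  have h1 : ∀ᶠ δ in 𝓝 (0 : ℝ), 0 < m + β * δ :=
    ContinuousAt.eventually_lt continuousAt_const (by fun_prop) (by simpa using hm)
  have h2 : ∀ᶠ δ in 𝓝 (0 : ℝ), 0 < (m + β * δ) ^ 2 - 4 * α * δ :=
    ContinuousAt.eventually_lt continuousAt_const (by fun_prop) (by simpa using pow_pos hm 2)
  filter_upwards [h1, h2] with δ h1 h2
  have hS2 : √((m + β * δ) ^ 2 - 4 * α * δ) ^ 2 = (m + β * δ) ^ 2 - 4 * α * δ := Real.sq_sqrt h2.le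
  have hpos : 0 < m + β * δ + √((m + β * δ) ^ 2 - 4 * α * δ) := add_pos h1 (Real.sqrt_pos.2 h2)
  refine ⟨h1, ?_, fun h => div_pos (by linarith) hpos⟩
  have hT : threshold m α β δ * (m + β * δ + √((m + β * δ) ^ 2 - 4 * α * δ)) = -2 * δ :=
    div_mul_cancel₀ _ hpos.ne'
  generalize threshold m α β δ = T at hT
  generalize √((m + β * δ) ^ 2 - 4 * α * δ) = S at hT hS2 hpos
  refine (mul_eq_zero.1 (?_ : (m + β * δ + S) ^ 2 * _ = 0)).resolve_left (pow_pos hpos 2).ne'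
  linear_combination ((m + β * δ) * (m + β * δ + S) + α * (T * (m + β * δ + S) - 2 * δ)) * hT
    + δ * hS2

theorem continuousAt_threshold {m : ℝ} (hm : 0 < m) (α β : ℝ) :
    ContinuousAt (threshold m α β) 0 := by
  unfold threshold
  refine ContinuousAt.div (by fun_prop) (by fun_prop) ?_
  simp [Real.sqrt_sq hm.le, hm.ne']

theorem threshold_spec {m : ℝ} (hm : 0 < m) (α β : ℝ) :
    ∀ᶠ E₀ in 𝓝[>] (0 : ℝ), ∀ᶠ δ in 𝓝[<] (0 : ℝ),
    threshold m α β δ ∈ Ioo 0 E₀ ∧ ∀ E ∈ Ioo 0 E₀, ∃ κ > 0,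
      δ + m * E + α * E ^ 2 + β * δ * E = κ * (E - threshold m α β δ) := by
  have hE : ∀ᶠ E₀ in 𝓝 (0 : ℝ), 2 * |α| * E₀ < m / 2 :=
    ContinuousAt.eventually_lt (by fun_prop) continuousAt_const (by simpa using hm)
  filter_upwards [nhdsWithin_le_nhds hE, self_mem_nhdsWithin] with E₀ hE₀ hpos
  have h1 : ∀ᶠ δ in 𝓝 (0 : ℝ), threshold m α β δ < E₀ :=
    (continuousAt_threshold hm α β).eventually_lt continuousAt_const
      (by simpa [threshold] using hpos)
  have h2 : ∀ᶠ δ in 𝓝 (0 : ℝ), m / 2 < m + β * δ :=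
    ContinuousAt.eventually_lt continuousAt_const (by fun_prop) (by simpa using hm)
  filter_upwards [nhdsWithin_le_nhds h1, nhdsWithin_le_nhds h2,
    nhdsWithin_le_nhds (threshold_root hm α β), self_mem_nhdsWithin] with δ h1 h2 h3 hδ
  obtain ⟨-, h3, h4⟩ := h3
  have h4 := h4 hδ
  refine ⟨⟨h4, h1⟩, fun E hE => ⟨m + β * δ + α * (E + threshold m α β δ), ?_, ?_⟩⟩
  · have : |α * (E + threshold m α β δ)| ≤ |α| * (2 * E₀) := by
      rw [abs_mul]
      refine mul_le_mul_of_nonneg_left ?_ (abs_nonneg _)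
      rw [abs_of_pos (add_pos hE.1 h4)]
      linarith [hE.2]
    have := (abs_le.1 this).1
    show 0 < _
    linarith
  · linear_combination h3

theorem threshold_expansion {m : ℝ} (hm : 0 < m) (α β : ℝ) :
    (fun δ => threshold m α β δ - (-1 / m * δ + (β * m - α) / m ^ 3 * δ ^ 2))
      =O[𝓝[<] (0 : ℝ)] fun δ => δ ^ 3 := by
  set l := -1 / m with hl
  set q := (β * m - α) / m ^ 3 with hq
  set T := threshold m α β
  have hTc : ContinuousAt T 0 := continuousAt_threshold hm α β
  have hT0 : T 0 = 0 := by simp [T, threshold]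
  -- the remainder divided by `δ³`: the equation at the truncated series over its divided difference
  set g : ℝ → ℝ := fun δ => -(2 * α * l * q + α * q ^ 2 * δ + β * q)
    / (m + β * δ + α * (T δ + (l * δ + q * δ ^ 2))) with hg
  have hgc : ContinuousAt g 0 := by
    refine ContinuousAt.div (by fun_prop) (by fun_prop) ?_
    simp [hT0, hm.ne']
  have hden : ∀ᶠ δ in 𝓝 (0 : ℝ), 0 < m + β * δ + α * (T δ + (l * δ + q * δ ^ 2)) :=
    ContinuousAt.eventually_lt continuousAt_const (by fun_prop) (by simpa [hT0] using hm)
  have heq : (fun δ => T δ - (l * δ + q * δ ^ 2)) =ᶠ[𝓝[<] (0 : ℝ)] fun δ => δ ^ 3 * g δ := by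
    filter_upwards [nhdsWithin_le_nhds hden, nhdsWithin_le_nhds (threshold_root hm α β)]
      with δ h1 h2
    have h2 : δ + m * T δ + α * T δ ^ 2 + β * δ * T δ = 0 := h2.2.1
    have hl' : 1 + m * l = 0 := by
      rw [hl]
      field_simp
      ring
    have hq' : m * q + α * l ^ 2 + β * l = 0 := by
      rw [hl, hq]
      field_simp
      ring
    simp only [hg]
    rw [mul_div_assoc', eq_div_iff h1.ne']
    linear_combination h2 - δ * hl' - δ ^ 2 * hq'
  refine heq.trans_isBigO ?_
  have h1 : g =O[𝓝[<] (0 : ℝ)] fun _ => (1 : ℝ) :=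
    (hgc.tendsto.mono_left nhdsWithin_le_nhds).isBigO_one ℝ
  simpa using (isBigO_refl (fun δ : ℝ => δ ^ 3) (𝓝[<] (0 : ℝ))).mul h1

theorem hasExpansion_threshold {m : ℝ} (hm : 0 < m) (α β : ℝ) (N : ℕ) :
    HasExpansion N (threshold m ((N - 1) * α) ((N - 1) * β)) (-1 / m) ((β * m - α) / m ^ 3) := by
  refine ⟨?_, ?_⟩
  · rintro rfl
    refine Eventually.of_forall fun δ => ?_
    simp only [threshold, Nat.cast_one, sub_self, zero_mul, add_zero, mul_zero, sub_zero,
      Real.sqrt_sq hm.le]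
    field_simp
    ring
  · rintro rfl
    have h : ((2 : ℕ) : ℝ) - 1 = 1 := by norm_num
    simpa only [h, one_mul] using threshold_expansion hm α β

theorem HasExpansion.agree {N : ℕ} {f g : ℝ → ℝ} {l q q' : ℝ} (hf : HasExpansion N f l q)
    (hg : HasExpansion N g l q') : AgreeToFirstOrder N f g := by
  refine ⟨fun h => ?_, fun h => ?_⟩
  · filter_upwards [hf.1 h, hg.1 h] with δ h1 h2
    rw [h1, h2]
  · have h32 : (fun δ : ℝ => δ ^ 3) =O[𝓝[<] (0 : ℝ)] fun δ => δ ^ 2 :=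
      ((isLittleO_pow_pow (by norm_num)).mono nhdsWithin_le_nhds).isBigO
    have h1 := ((hf.2 h).trans h32).sub ((hg.2 h).trans h32)
    have h2 : (fun δ : ℝ => (q - q') * δ ^ 2) =O[𝓝[<] (0 : ℝ)] fun δ => δ ^ 2 :=
      (isBigO_refl _ _).const_mul_left _
    refine (h1.add h2).congr_left fun δ => ?_
    ring

theorem hasExpansion_linear (N : ℕ) (l : ℝ) : HasExpansion N (fun δ => l * δ) l 0 :=
  ⟨fun _ => Eventually.of_forall fun _ => rfl, fun _ => by simpa using isBigO_zero _ _⟩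

/-! ### Slopes at the modes as functions of the energy -/

/-- The slope between the two modes of the phase independent part: the Hamiltonian at `J = E`
exceeds that at `J = 0` by `E` times this number. -/
noncomputable def meanSlope (c : Coeffs) (n δ E : ℝ) : ℝ :=
  a1 c n δ E + a2 c n δ E * E + a3 c n * E ^ 2

section Slopes

variable (c : Coeffs) (n δ E : ℝ)

/-- The coefficient of `E` in `P'(0)`, for the inclined profile `P`. -/
noncomputable def m1I : ℝ := -4 * c.A + 2 * c.B + 12 * c.C

/-- The coefficient of `E` in `M'(0)`, for the loop profile `M`. -/
noncomputable def m1L : ℝ := -4 * c.A + 2 * c.B + 4 * c.C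

/-- The coefficient of `E` in `P'(E)`, for the inclined profile `P`. -/
noncomputable def m2I : ℝ := 4 * c.A + 2 * c.B - 12 * c.C

/-- The coefficient of `E` in `M'(E)`, for the loop profile `M`. -/
noncomputable def m2L : ℝ := 4 * c.A + 2 * c.B - 4 * c.C

/-- The coefficient of `E` in the mean slope. -/
noncomputable def mGB : ℝ := 2 * c.B

/-- For `n = 1`, the coefficient of `E²` in `P'(0)`, for the inclined profile `P`. -/
noncomputable def α1I : ℝ := kA1 c + kB1 c

/-- For `n = 1`, the coefficient of `E²` in `M'(0)`, for the loop profile `M`. -/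
noncomputable def α1L : ℝ := kA1 c - kB1 c

/-- For `n = 1`, the coefficient of `E²` in `P'(E)`, for the inclined profile `P`. -/
noncomputable def α2I : ℝ := kA1 c + 2 * kA2 c + 3 * kA3 c - kB1 c + kB3 c

/-- For `n = 1`, the coefficient of `E²` in `M'(E)`, for the loop profile `M`. -/
noncomputable def α2L : ℝ := kA1 c + 2 * kA2 c + 3 * kA3 c + kB1 c - kB3 c

/-- For `n = 1`, the coefficient of `E²` in the mean slope. -/
noncomputable def αGB : ℝ := kA1 c + kA2 c + kA3 c

/-- For `n = 1`, the coefficient of `δ E` in `P'(0)`, for the inclined profile `P`. -/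
noncomputable def β1I : ℝ := -12 * c.C

/-- For `n = 1`, the coefficient of `δ E` in `M'(0)`, for the loop profile `M`. -/
noncomputable def β1L : ℝ := -4 * c.C

/-- For `n = 1`, the coefficient of `δ E` in `P'(E)`, for the inclined profile `P`. -/
noncomputable def β2I : ℝ := 4 * (4 * c.C - 2 * c.A - c.B) - 4 * c.C

/-- For `n = 1`, the coefficient of `δ E` in `M'(E)`, for the loop profile `M`. -/
noncomputable def β2L : ℝ := 4 * (4 * c.C - 2 * c.A - c.B) - 12 * c.C

/-- For `n = 1`, the coefficient of `δ E` in the mean slope. -/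
noncomputable def βGB : ℝ := -8 * c.C + 2 * (4 * c.C - 2 * c.A - c.B)

theorem incl1_eq :
    incl1 c n δ E = δ + m1I c * E + n * α1I c * E ^ 2 + n * β1I c * δ * E := by
  simp only [incl1, a1, b0, m1I, α1I, β1I]
  ring

theorem loop1_eq :
    loop1 c n δ E = δ + m1L c * E + n * α1L c * E ^ 2 + n * β1L c * δ * E := by
  simp only [loop1, a1, b0, m1L, α1L, β1L]
  ring

theorem inclEnd_eq :
    inclEnd c n δ E = δ + m2I c * E + n * α2I c * E ^ 2 + n * β2I c * δ * E := by
  simp only [inclEnd, incl1, incl2, incl3, a1, a2, a3, b0, b1, m2I, α2I, β2I]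
  ring

theorem loopEnd_eq :
    loopEnd c n δ E = δ + m2L c * E + n * α2L c * E ^ 2 + n * β2L c * δ * E := by
  simp only [loopEnd, loop1, loop2, loop3, a1, a2, a3, b0, b1, m2L, α2L, β2L]
  ring

theorem meanSlope_eq :
    meanSlope c n δ E = δ + mGB c * E + n * αGB c * E ^ 2 + n * βGB c * δ * E := by
  simp only [meanSlope, a1, a2, a3, mGB, αGB, βGB]
  ring

@[fun_prop] theorem continuous_incl1 : Continuous (incl1 c n δ) := by
  unfold incl1 a1 b0
  fun_prop

@[fun_prop] theorem continuous_loop1 : Continuous (loop1 c n δ) := by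
  unfold loop1 a1 b0
  fun_prop

@[fun_prop] theorem continuous_incl2 : Continuous (incl2 c n δ) := by
  unfold incl2 a2 b0
  fun_prop

@[fun_prop] theorem continuous_loop2 : Continuous (loop2 c n δ) := by
  unfold loop2 a2 b0
  fun_prop

@[fun_prop] theorem continuous_inclEnd : Continuous (inclEnd c n δ) := by
  unfold inclEnd
  fun_prop

@[fun_prop] theorem continuous_loopEnd : Continuous (loopEnd c n δ) := by
  unfold loopEnd
  fun_prop

variable {c}

theorem expansion_1I (h : 0 < m1I c) (N : ℕ) :
    HasExpansion N (threshold (m1I c) ((N - 1) * α1I c) ((N - 1) * β1I c))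
      (lead1I c) (quad1I c) := by
  have h0 : 2 * c.A - c.B - 6 * c.C = -m1I c / 2 := by
    unfold m1I
    ring
  convert hasExpansion_threshold h (α1I c) (β1I c) N using 1
  · rw [lead1I, h0]
    field_simp
  · rw [quad1I, h0]
    field_simp
    simp only [m1I, α1I, β1I, kA1, kB1]
    ring

theorem expansion_1L (h : 0 < m1L c) (N : ℕ) :
    HasExpansion N (threshold (m1L c) ((N - 1) * α1L c) ((N - 1) * β1L c))
      (lead1L c) (quad1L c) := by
  have h0 : 2 * c.A - c.B - 2 * c.C = -m1L c / 2 := by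
    unfold m1L
    ring
  convert hasExpansion_threshold h (α1L c) (β1L c) N using 1
  · rw [lead1L, h0]
    field_simp
  · rw [quad1L, h0]
    field_simp
    simp only [m1L, α1L, β1L, kA1, kB1]
    ring

theorem expansion_2I (h : 0 < m2I c) (N : ℕ) :
    HasExpansion N (threshold (m2I c) ((N - 1) * α2I c) ((N - 1) * β2I c))
      (lead2I c) (quad2I c) := by
  have h0 : 2 * c.A + c.B - 6 * c.C = m2I c / 2 := by
    unfold m2I
    ring
  convert hasExpansion_threshold h (α2I c) (β2I c) N using 1
  · rw [lead2I, h0]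
    field_simp
  · rw [quad2I, h0]
    field_simp
    simp only [m2I, α2I, β2I, kA1, kA2, kA3, kB1, kB3]
    ring

theorem expansion_2L (h : 0 < m2L c) (N : ℕ) :
    HasExpansion N (threshold (m2L c) ((N - 1) * α2L c) ((N - 1) * β2L c))
      (lead2L c) (quad2L c) := by
  have h0 : 2 * c.A + c.B - 2 * c.C = m2L c / 2 := by
    unfold m2L
    ring
  convert hasExpansion_threshold h (α2L c) (β2L c) N using 1
  · rw [lead2L, h0]
    field_simp
  · rw [quad2L, h0]
    field_simp
    simp only [m2L, α2L, β2L, kA1, kA2, kA3, kB1, kB3]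
    ring

theorem agree_GB (h : 0 < mGB c) (N : ℕ) :
    AgreeToFirstOrder N (threshold (mGB c) ((N - 1) * αGB c) ((N - 1) * βGB c))
      (fun δ => leadGB c * δ) :=
  (hasExpansion_threshold h (αGB c) (βGB c) N).agree (hasExpansion_linear N (leadGB c))

end Slopes

/-! ### Small energies and detunings -/

/-- The open conditions that hold near `δ = E = 0` and from which all bifurcations follow: convexity
of the inclined and concavity of the loop profile, a nonzero amplitude of the phase dependent part,
the level `cos 2ψ = (a₂ + a₃ (J + E)) / (b₀ + b₁ J)` of the modes lying strictly between `-1` and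
`1`, and the order of the slopes belonging to different modes. -/
structure IsSmall (c : Coeffs) (n δ E : ℝ) : Prop where
  convex : ∀ J ∈ Icc 0 E, 0 < incl2 c n δ E + 3 * incl3 c n * J
  concave : ∀ J ∈ Icc 0 E, loop2 c n δ E + 3 * loop3 c n * J < 0
  amp : ∀ J ∈ Icc 0 E, b0 c n δ E + b1 c n * J < 0
  level : ∀ J ∈ Icc 0 E, b0 c n δ E + b1 c n * J < a2 c n δ E + a3 c n * (J + E)
  level' : ∀ J ∈ Icc 0 E, b0 c n δ E + b1 c n * J < -(a2 c n δ E + a3 c n * (J + E))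
  order : c.A - 2 * c.C ≠ 0 →
    0 < (c.A - 2 * c.C) * (2 * b0 c n δ E + 2 * incl2 c n δ E + 3 * incl3 c n * E)
  order' : c.A - 2 * c.C ≠ 0 →
    0 < (c.A - 2 * c.C) * (2 * loop2 c n δ E + 3 * loop3 c n * E - 2 * b0 c n δ E)

theorem eventually_isSmall {c : Coeffs} (hP : 0 < c.A - 3 * c.C) (hQ : c.A - c.C < 0) (n : ℝ) :
    ∀ᶠ E₀ in 𝓝[>] (0 : ℝ), ∀ᶠ δ in 𝓝[<] (0 : ℝ), ∀ E ∈ Ioo 0 E₀, IsSmall c n δ E := by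
  have pos : ∀ {f : ℝ × ℝ × ℝ → ℝ}, Continuous f → 0 < f 0 → ∀ᶠ z in 𝓝 0, 0 < f z :=
    fun hf h => continuousAt_const.eventually_lt hf.continuousAt h
  have k1 := pos (f := fun z => incl2 c n z.1 z.2.1 + 3 * incl3 c n * z.2.2)
    (by unfold incl2 a2 b0; fun_prop) (by simp [incl2, a2, b0]; linarith)
  have k2 := pos (f := fun z => -(loop2 c n z.1 z.2.1 + 3 * loop3 c n * z.2.2))
    (by unfold loop2 a2 b0; fun_prop) (by simp [loop2, a2, b0]; linarith)
  have k3 := pos (f := fun z => -(b0 c n z.1 z.2.1 + b1 c n * z.2.2))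
    (by unfold b0; fun_prop) (by simp [b0]; linarith)
  have k4 := pos (f := fun z => a2 c n z.1 z.2.1 + a3 c n * (z.2.2 + z.2.1)
      - (b0 c n z.1 z.2.1 + b1 c n * z.2.2))
    (by unfold a2 b0; fun_prop) (by simp [a2, b0]; linarith)
  have k5 := pos (f := fun z => -(a2 c n z.1 z.2.1 + a3 c n * (z.2.2 + z.2.1))
      - (b0 c n z.1 z.2.1 + b1 c n * z.2.2))
    (by unfold a2 b0; fun_prop) (by simp [a2, b0]; linarith)
  have k6 : ∀ᶠ z : ℝ × ℝ × ℝ in 𝓝 0, c.A - 2 * c.C ≠ 0 → 0 < (c.A - 2 * c.C) *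
      (2 * b0 c n z.1 z.2.1 + 2 * incl2 c n z.1 z.2.1 + 3 * incl3 c n * z.2.1) := by
    by_cases h : c.A - 2 * c.C = 0
    · exact Eventually.of_forall fun _ h' => absurd h h'
    · refine (pos (by unfold incl2 a2 b0; fun_prop) ?_).mono fun z hz _ => hz
      have := mul_self_pos.2 h
      simp [incl2, a2, b0]
      nlinarith
  have k7 : ∀ᶠ z : ℝ × ℝ × ℝ in 𝓝 0, c.A - 2 * c.C ≠ 0 → 0 < (c.A - 2 * c.C) *
      (2 * loop2 c n z.1 z.2.1 + 3 * loop3 c n * z.2.1 - 2 * b0 c n z.1 z.2.1) := by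
    by_cases h : c.A - 2 * c.C = 0
    · exact Eventually.of_forall fun _ h' => absurd h h'
    · refine (pos (by unfold loop2 a2 b0; fun_prop) ?_).mono fun z hz _ => hz
      have := mul_self_pos.2 h
      simp [loop2, a2, b0]
      nlinarith
  obtain ⟨ε, hε, hall⟩ := Metric.eventually_nhds_iff.1
    (k1.and (k2.and (k3.and (k4.and (k5.and (k6.and k7))))))
  filter_upwards [Ioo_mem_nhdsGT hε] with E₀ hE₀
  filter_upwards [Ioo_mem_nhdsLT (neg_lt_zero.2 hε)] with δ hδ E hE
  have hJ : ∀ J ∈ Icc 0 E, dist (δ, E, J) (0 : ℝ × ℝ × ℝ) < ε := by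
    intro J hJ
    simp only [Prod.dist_eq, Prod.fst_zero, Prod.snd_zero, Real.dist_eq, sub_zero, max_lt_iff,
      abs_lt]
    refine ⟨⟨?_, ?_⟩, ⟨?_, ?_⟩, ?_, ?_⟩ <;> linarith [hJ.1, hJ.2, hE.1, hE.2, hE₀.1, hE₀.2, hδ.1, hδ.2]
  have h0 : (0 : ℝ) ∈ Icc 0 E := left_mem_Icc.2 hE.1.le
  exact
    { convex := fun J h => (hall (hJ J h)).1
      concave := fun J h => neg_pos.1 (hall (hJ J h)).2.1
      amp := fun J h => neg_pos.1 (hall (hJ J h)).2.2.1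
      level := fun J h => sub_pos.1 (hall (hJ J h)).2.2.2.1
      level' := fun J h => sub_pos.1 (hall (hJ J h)).2.2.2.2.1
      order := (hall (hJ 0 h0)).2.2.2.2.2.1
      order' := (hall (hJ 0 h0)).2.2.2.2.2.2 }

namespace IsSmall

variable {c : Coeffs} {n δ E : ℝ}

theorem incl1_lt_loop1 (h : IsSmall c n δ E) (hE : 0 < E) : incl1 c n δ E < loop1 c n δ E := by
  have := h.amp 0 (left_mem_Icc.2 hE.le)
  simp only [incl1, loop1]
  nlinarith

theorem loopEnd_lt_inclEnd (h : IsSmall c n δ E) (hE : 0 < E) :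
    loopEnd c n δ E < inclEnd c n δ E := by
  have := mul_neg_of_pos_of_neg hE (h.amp E (right_mem_Icc.2 hE.le))
  simp only [inclEnd, loopEnd, incl1, incl2, incl3, loop1, loop2, loop3]
  nlinarith

theorem incl1_lt_meanSlope (h : IsSmall c n δ E) (hE : 0 < E) :
    incl1 c n δ E < meanSlope c n δ E := by
  have h0 := mul_pos hE (h.convex 0 (left_mem_Icc.2 hE.le))
  have h1 := mul_pos hE (h.convex E (right_mem_Icc.2 hE.le))
  simp only [meanSlope, incl1, incl2, incl3] at *
  nlinarith

theorem meanSlope_lt_inclEnd (h : IsSmall c n δ E) (hE : 0 < E) :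
    meanSlope c n δ E < inclEnd c n δ E := by
  have h0 := mul_pos hE (h.convex 0 (left_mem_Icc.2 hE.le))
  have h1 := mul_pos hE (h.convex E (right_mem_Icc.2 hE.le))
  simp only [meanSlope, inclEnd, incl1, incl2, incl3] at *
  nlinarith

theorem meanSlope_lt_loop1 (h : IsSmall c n δ E) (hE : 0 < E) :
    meanSlope c n δ E < loop1 c n δ E := by
  have h0 := mul_neg_of_pos_of_neg hE (h.concave 0 (left_mem_Icc.2 hE.le))
  have h1 := mul_neg_of_pos_of_neg hE (h.concave E (right_mem_Icc.2 hE.le))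
  simp only [meanSlope, loop1, loop2, loop3] at *
  nlinarith

theorem loopEnd_lt_meanSlope (h : IsSmall c n δ E) (hE : 0 < E) :
    loopEnd c n δ E < meanSlope c n δ E := by
  have h0 := mul_neg_of_pos_of_neg hE (h.concave 0 (left_mem_Icc.2 hE.le))
  have h1 := mul_neg_of_pos_of_neg hE (h.concave E (right_mem_Icc.2 hE.le))
  simp only [meanSlope, loopEnd, loop1, loop2, loop3] at *
  nlinarith

theorem order_modes (h : IsSmall c n δ E) (hE : 0 < E) (hne : c.A - 2 * c.C ≠ 0) :
    0 < (c.A - 2 * c.C) * (inclEnd c n δ E - loop1 c n δ E) := by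
  have := mul_pos hE (h.order hne)
  simp only [inclEnd, incl1, loop1]
  linear_combination this

theorem order_modes' (h : IsSmall c n δ E) (hE : 0 < E) (hne : c.A - 2 * c.C ≠ 0) :
    0 < (c.A - 2 * c.C) * (loopEnd c n δ E - incl1 c n δ E) := by
  have := mul_pos hE (h.order' hne)
  simp only [loopEnd, incl1, loop1]
  linear_combination this

end IsSmall

/-! ### Bifurcations from sign changes of the slopes -/

/-- On `(0, E₀)` the function `f` is negative before `s`, zero at `s` and positive after `s`. -/
def SignChange (f : ℝ → ℝ) (E₀ s : ℝ) : Prop :=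
  s ∈ Ioo 0 E₀ ∧ ∀ E ∈ Ioo 0 E₀, ∃ κ > 0, f E = κ * (E - s)

namespace SignChange

variable {f : ℝ → ℝ} {E₀ s E : ℝ}

theorem neg_iff (h : SignChange f E₀ s) (hE : E ∈ Ioo 0 E₀) : f E < 0 ↔ E < s := by
  obtain ⟨κ, hκ, e⟩ := h.2 E hE
  rw [e, ← smul_eq_mul, smul_neg_iff_of_pos_left hκ, sub_neg]

theorem pos_iff (h : SignChange f E₀ s) (hE : E ∈ Ioo 0 E₀) : 0 < f E ↔ s < E := by
  obtain ⟨κ, hκ, e⟩ := h.2 E hE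
  rw [e, mul_pos_iff_of_pos_left hκ, sub_pos]

theorem eq_zero_iff (h : SignChange f E₀ s) (hE : E ∈ Ioo 0 E₀) : f E = 0 ↔ E = s := by
  obtain ⟨κ, hκ, e⟩ := h.2 E hE
  rw [e, mul_eq_zero, or_iff_right hκ.ne', sub_eq_zero]

theorem apply_self (h : SignChange f E₀ s) : f s = 0 := (h.eq_zero_iff h.1).2 rfl

theorem eventually_neg (h : SignChange f E₀ s) : ∀ᶠ E in 𝓝 s, E < s → f E < 0 := by
  filter_upwards [Ioo_mem_nhds h.1.1 h.1.2] with E hE using (h.neg_iff hE).2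

theorem eventually_pos (h : SignChange f E₀ s) : ∀ᶠ E in 𝓝 s, s < E → 0 < f E := by
  filter_upwards [Ioo_mem_nhds h.1.1 h.1.2] with E hE using (h.pos_iff hE).2

end SignChange

theorem eventually_signChange {m α β : ℝ} (hm : 0 < m) {f : ℝ → ℝ → ℝ}
    (hf : ∀ δ E, f δ E = δ + m * E + α * E ^ 2 + β * δ * E) :
    ∀ᶠ E₀ in 𝓝[>] (0 : ℝ), ∀ᶠ δ in 𝓝[<] (0 : ℝ),
      SignChange (f δ) E₀ (threshold m α β δ) := by
  filter_upwards [threshold_spec hm α β] with E₀ h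
  filter_upwards [h] with δ h
  simpa only [SignChange, hf] using h

variable {c : Coeffs} {N : ℕ} {δ E₀ s E : ℝ}

theorem tendsto_neg_nhds (s : ℝ) : Tendsto (fun t : ℝ => -t) (𝓝 (-s)) (𝓝 s) := by
  simpa using (continuous_neg.tendsto (-s) : Tendsto (fun t : ℝ => -t) (𝓝 (-s)) (𝓝 (- -s)))

theorem bif1I_of_signChange (hN : N = 1 ∨ N = 2) (h : SignChange (incl1 c (N - 1) δ) E₀ s)
    (hs : IsSmall c (N - 1) δ s) : Bif1I c N δ s := by
  have h0 := h.apply_self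
  have h1 := hs.incl1_lt_loop1 h.1.1
  have h2 := hs.convex 0 (left_mem_Icc.2 h.1.1.le)
  unfold Bif1I IsAntiPitchfork
  simp only [chart1_eq hN]
  refine isPitchfork_planar (by fun_prop) (by fun_prop) (by fun_prop) (by fun_prop) (by fun_prop)
    (by fun_prop) ?_ ?_ ?_ ?_ ?_
  · rwa [neg_neg]
  · exact ((tendsto_neg_nhds s).eventually h.eventually_pos).mono fun t ht ht' => ht (by linarith)
  · exact ((tendsto_neg_nhds s).eventually h.eventually_neg).mono fun t ht ht' => ht (by linarith)
  · rw [neg_neg]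
    linarith
  · rw [neg_neg]
    linarith

theorem bif1L_of_signChange (hN : N = 1 ∨ N = 2) (h : SignChange (loop1 c (N - 1) δ) E₀ s)
    (hs : IsSmall c (N - 1) δ s) : Bif1L c N δ s := by
  have h0 := h.apply_self
  have h1 := hs.incl1_lt_loop1 h.1.1
  have h2 := hs.concave 0 (left_mem_Icc.2 h.1.1.le)
  unfold Bif1L
  rw [funext (chart1_eq hN δ)]
  exact isPitchfork_planar_snd (by fun_prop) (by fun_prop) (by fun_prop) (by fun_prop)
    (by fun_prop) (by fun_prop) h0 h.eventually_neg h.eventually_pos (by linarith) (by linarith)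

theorem bif2I_of_signChange (hN : N = 1 ∨ N = 2) (h : SignChange (inclEnd c (N - 1) δ) E₀ s)
    (hs : IsSmall c (N - 1) δ s) : Bif2I c N δ s := by
  have h0 := h.apply_self
  have h1 := hs.loopEnd_lt_inclEnd h.1.1
  have h2 := hs.convex s (right_mem_Icc.2 h.1.1.le)
  unfold Bif2I
  rw [funext (chart2_eq hN δ)]
  exact isPitchfork_planar (by fun_prop) (by fun_prop) (by fun_prop) (by fun_prop)
    (by fun_prop) (by fun_prop) (by linarith)
    (h.eventually_neg.mono fun t ht ht' => by linarith [ht ht'])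
    (h.eventually_pos.mono fun t ht ht' => by linarith [ht ht']) (by linarith) (by linarith)

theorem bif2L_of_signChange (hN : N = 1 ∨ N = 2) (h : SignChange (loopEnd c (N - 1) δ) E₀ s)
    (hs : IsSmall c (N - 1) δ s) : Bif2L c N δ s := by
  have h0 := h.apply_self
  have h1 := hs.loopEnd_lt_inclEnd h.1.1
  have h2 := hs.concave s (right_mem_Icc.2 h.1.1.le)
  unfold Bif2L IsAntiPitchfork
  simp only [chart2_eq hN]
  refine isPitchfork_planar_snd (by fun_prop) (by fun_prop) (by fun_prop) (by fun_prop)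
    (by fun_prop) (by fun_prop) ?_ ?_ ?_ ?_ ?_
  · rw [neg_neg]
    linarith
  · refine ((tendsto_neg_nhds s).eventually h.eventually_pos).mono fun t ht ht' => ?_
    linarith [ht (by linarith)]
  · refine ((tendsto_neg_nhds s).eventually h.eventually_neg).mono fun t ht ht' => ?_
    linarith [ht (by linarith)]
  · rw [neg_neg]
    linarith
  · rw [neg_neg]
    linarith

/-- The modes are connected exactly when the Hamiltonian takes the same value at both. -/
theorem hasHeteroclinic_iff (hN : N = 1 ∨ N = 2) (hs : IsSmall c (N - 1) δ E) (hE : 0 < E) :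
    HasHeteroclinic c N δ E ↔ meanSlope c (N - 1) δ E = 0 := by
  have hP := hasDerivAt_cubic (a0 c (N - 1) E) (incl1 c (N - 1) δ E) (incl2 c (N - 1) δ E)
    (incl3 c (N - 1))
  have hM := hasDerivAt_cubic (a0 c (N - 1) E) (loop1 c (N - 1) δ E) (loop2 c (N - 1) δ E)
    (loop3 c (N - 1))
  unfold HasHeteroclinic
  rw [ham_eq hN]
  unfold inclPoly loopPoly
  constructor
  · rintro ⟨γ, hγ, hbot, htop⟩
    have h := eq_of_connecting_orbit hP hM (by simp [cubic])
      (by simp only [cubic, incl1, incl2, incl3, loop1, loop2, loop3]; ring)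
      (fun t => (hγ t).1) hbot htop
    have h' : E * meanSlope c (N - 1) δ E = 0 := by
      simp only [cubic, incl1, incl2, incl3] at h
      simp only [meanSlope]
      linear_combination -h
    exact (mul_eq_zero.1 h').resolve_left hE.ne'
  · intro h
    simp only [meanSlope] at h
    refine exists_connecting_orbit (k := a0 c (N - 1) E)
      (Q := fun x => a2 c (N - 1) δ E + a3 c (N - 1) * (x + E))
      (Q' := fun _ => a3 c (N - 1))
      (S := fun x => b0 c (N - 1) δ E + b1 c (N - 1) * x) (S' := fun _ => b1 c (N - 1))
      hE hP hM (fun x => ?_) (fun x => ?_) (fun x => ?_) (fun x => ?_) hs.level hs.level'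
    · simpa using (((hasDerivAt_id' x).add_const E).const_mul (a3 c (N - 1))).const_add
        (a2 c (N - 1) δ E)
    · simpa using ((hasDerivAt_id' x).const_mul (b1 c (N - 1))).const_add (b0 c (N - 1) δ E)
    · simp only [cubic, incl1, incl2, incl3]
      linear_combination x * h
    · simp only [cubic, loop1, loop2, loop3]
      linear_combination x * h

/-- A heteroclinic connection needs equal energies of the two modes. The chord slope between them
then vanishes, and convexity of the inclined and concavity of the loop profile make both modes
saddles. -/
theorem bifGB_of_signChange (hN : N = 1 ∨ N = 2)
    (h : SignChange (meanSlope c (N - 1) δ) E₀ s)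
    (hs : ∀ E ∈ Ioo 0 E₀, IsSmall c (N - 1) δ E) : BifGB c N δ s := by
  have h0 := h.apply_self
  have hs' := hs s h.1
  have g1 := hs'.incl1_lt_meanSlope h.1.1
  have g2 := hs'.meanSlope_lt_inclEnd h.1.1
  have g3 := hs'.meanSlope_lt_loop1 h.1.1
  have g4 := hs'.loopEnd_lt_meanSlope h.1.1
  rw [h0] at g1 g2 g3 g4
  have e1 : ∀ᶠ E in 𝓝 s, incl1 c (N - 1) δ E < 0 :=
    ContinuousAt.eventually_lt (by fun_prop) continuousAt_const g1
  have e2 : ∀ᶠ E in 𝓝 s, 0 < inclEnd c (N - 1) δ E :=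
    ContinuousAt.eventually_lt continuousAt_const (by fun_prop) g2
  have e3 : ∀ᶠ E in 𝓝 s, 0 < loop1 c (N - 1) δ E :=
    ContinuousAt.eventually_lt continuousAt_const (by fun_prop) g3
  have e4 : ∀ᶠ E in 𝓝 s, loopEnd c (N - 1) δ E < 0 :=
    ContinuousAt.eventually_lt (by fun_prop) continuousAt_const g4
  obtain ⟨η, hη, hall⟩ := Metric.eventually_nhds_iff.1
    (e1.and (e2.and (e3.and (e4.and (Ioo_mem_nhds h.1.1 h.1.2)))))
  refine ⟨η, hη, fun E hE => ?_⟩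
  obtain ⟨f1, f2, f3, f4, f5⟩ := hall (y := E) (by
    rw [Real.dist_eq, abs_lt]
    constructor <;> linarith [hE.1, hE.2])
  refine ⟨?_, ?_, ?_⟩
  · rw [chart1_eq hN, isSaddle_planar_zero]
    exact mul_neg_of_neg_of_pos f1 f3
  · rw [chart2_eq hN, isSaddle_planar_zero]
    nlinarith
  · rw [hasHeteroclinic_iff hN (hs E f5) f5.1, h.eq_zero_iff f5]

theorem isCenter_of_isEquilibrium (hN : N = 1 ∨ N = 2) (hs : IsSmall c (N - 1) δ E) {p : ℝ × ℝ}
    (hp : p.1 ∈ Ioo 0 E) (h : IsEquilibrium (ham c N δ E) p) :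
    IsCenter (ham c N δ E) p ∧ (Real.sin p.2 = 0 ∨ Real.cos p.2 = 0) := by
  have hp' := Ioo_subset_Icc_self hp
  rw [ham_eq hN] at h ⊢
  unfold inclPoly loopPoly at h ⊢
  refine isCenter_phaseHam (hasDerivAt_cubic _ _ _ _) (hasDerivAt_cubic _ _ _ _)
    (hasDerivAt_quadratic _ _ _) (hasDerivAt_quadratic _ _ _) ?_ ?_ ?_ h
  · have := mul_neg_of_pos_of_neg (mul_pos hp.1 (sub_pos.2 hp.2)) (hs.amp _ hp')
    simp only [cubic, incl1, incl2, incl3, loop1, loop2, loop3]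
    linear_combination 2 * this
  · linarith [hs.convex _ hp']
  · linarith [hs.concave _ hp']

theorem isRegularEnergy_iff (hN : N = 1 ∨ N = 2) (hs : IsSmall c (N - 1) δ E) (hE : 0 < E) :
    IsRegularEnergy c N δ E ↔ incl1 c (N - 1) δ E ≠ 0 ∧ loop1 c (N - 1) δ E ≠ 0 ∧
      inclEnd c (N - 1) δ E ≠ 0 ∧ loopEnd c (N - 1) δ E ≠ 0 ∧ meanSlope c (N - 1) δ E ≠ 0 := by
  have hi : ∀ p : ℝ × ℝ, p.1 ∈ Ioo 0 E → IsEquilibrium (ham c N δ E) p →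
      IsCenter (ham c N δ E) p ∨ IsSaddle (ham c N δ E) p :=
    fun p hp h => Or.inl (isCenter_of_isEquilibrium hN hs hp h).1
  have hor : ∀ x : ℝ, (0 < x ∨ x < 0) ↔ x ≠ 0 := fun x => by rw [or_comm, ne_iff_lt_or_gt]
  unfold IsRegularEnergy
  rw [hasHeteroclinic_iff hN hs hE, chart1_eq hN, chart2_eq hN, isCenter_planar_zero,
    isSaddle_planar_zero, isCenter_planar_zero, isSaddle_planar_zero, hor, hor]
  simp only [mul_ne_zero_iff, neg_ne_zero]
  tauto

/-- The five thresholds are the only bifurcation values. The sign of a slope at the threshold of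
another slope decides the order of the two thresholds. -/
theorem bifurcation_sequence {s1I s1L s2I s2L sGB : ℝ} (hN : N = 1 ∨ N = 2)
    (hs : ∀ E ∈ Ioo 0 E₀, IsSmall c (N - 1) δ E)
    (f1 : SignChange (incl1 c (N - 1) δ) E₀ s1I) (f2 : SignChange (loop1 c (N - 1) δ) E₀ s1L)
    (f3 : SignChange (inclEnd c (N - 1) δ) E₀ s2I) (f4 : SignChange (loopEnd c (N - 1) δ) E₀ s2L)
    (f5 : SignChange (meanSlope c (N - 1) δ) E₀ sGB) :
    {E ∈ Ioo 0 E₀ | ¬ IsRegularEnergy c N δ E} = {s1I, s1L, s2I, s2L, sGB} ∧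
      (c.A - 2 * c.C < 0 → s1L < s2I ∧ s2I < sGB ∧ sGB < s1I ∧ s1I < s2L) ∧
      (0 < c.A - 2 * c.C → s2I < s1L ∧ s1L < sGB ∧ sGB < s2L ∧ s2L < s1I) ∧
      (c.A = 2 * c.C → s1L < sGB ∧ s2I < sGB ∧ sGB < s1I ∧ sGB < s2L) := by
  have hGB := hs _ f5.1
  have z := f5.apply_self
  -- the order relative to the global bifurcation, from the signs of the other slopes there
  have o1 : sGB < s1I := (f1.neg_iff f5.1).1 (z ▸ hGB.incl1_lt_meanSlope f5.1.1)
  have o2 : s1L < sGB := (f2.pos_iff f5.1).1 (z ▸ hGB.meanSlope_lt_loop1 f5.1.1)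
  have o3 : s2I < sGB := (f3.pos_iff f5.1).1 (z ▸ hGB.meanSlope_lt_inclEnd f5.1.1)
  have o4 : sGB < s2L := (f4.neg_iff f5.1).1 (z ▸ hGB.loopEnd_lt_meanSlope f5.1.1)
  have r1 := (hs _ f2.1).order_modes f2.1.1
  have r2 := (hs _ f1.1).order_modes' f1.1.1
  rw [f2.apply_self, sub_zero] at r1
  rw [f1.apply_self, sub_zero] at r2
  refine ⟨?_, fun h => ⟨?_, o3, o1, ?_⟩, fun h => ⟨?_, o2, o4, ?_⟩, fun _ => ⟨o2, o3, o1, o4⟩⟩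
  · ext E
    simp only [mem_ofPred_eq, mem_insert_iff, mem_singleton_iff]
    constructor
    · rintro ⟨hE, hr⟩
      rw [isRegularEnergy_iff hN (hs E hE) hE.1] at hr
      simp only [ne_eq, f1.eq_zero_iff hE, f2.eq_zero_iff hE, f3.eq_zero_iff hE,
        f4.eq_zero_iff hE, f5.eq_zero_iff hE] at hr
      tauto
    · intro h
      have hE : E ∈ Ioo 0 E₀ := by
        rcases h with rfl | rfl | rfl | rfl | rfl
        exacts [f1.1, f2.1, f3.1, f4.1, f5.1]
      refine ⟨hE, ?_⟩
      rw [isRegularEnergy_iff hN (hs E hE) hE.1]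
      simp only [ne_eq, f1.eq_zero_iff hE, f2.eq_zero_iff hE, f3.eq_zero_iff hE,
        f4.eq_zero_iff hE, f5.eq_zero_iff hE]
      tauto
  · exact (f3.neg_iff f2.1).1 (neg_of_mul_pos_right (r1 h.ne) h.le)
  · exact (f4.neg_iff f1.1).1 (neg_of_mul_pos_right (r2 h.ne) h.le)
  · exact (f3.pos_iff f2.1).1 ((mul_pos_iff_of_pos_left h).1 (r1 h.ne'))
  · exact (f4.pos_iff f1.1).1 ((mul_pos_iff_of_pos_left h).1 (r2 h.ne'))

end Resonance22

theorem proposition9 (c : Coeffs) (N : ℕ) (hN : N = 1 ∨ N = 2)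
    (hC : c.C ≠ 0) (hP : 0 < c.A - 3 * c.C) (hQ : c.A - c.C < 0) :
    ∃ δ₀ > (0 : ℝ), ∃ E₀ > (0 : ℝ), ∃ E1I E1L E2I E2L EGB : ℝ → ℝ,
      -- the individual bifurcations, each under its own condition on `B`
      (2 * (c.A - 3 * c.C) < c.B →
        HasExpansion N E1I (lead1I c) (quad1I c) ∧
        ∀ δ ∈ Ioo (-δ₀) 0, E1I δ ∈ Ioo 0 E₀ ∧ Bif1I c N δ (E1I δ)) ∧
      (2 * (c.A - c.C) < c.B →
        HasExpansion N E1L (lead1L c) (quad1L c) ∧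
        ∀ δ ∈ Ioo (-δ₀) 0, E1L δ ∈ Ioo 0 E₀ ∧ Bif1L c N δ (E1L δ)) ∧
      (2 * (3 * c.C - c.A) < c.B →
        HasExpansion N E2I (lead2I c) (quad2I c) ∧
        ∀ δ ∈ Ioo (-δ₀) 0, E2I δ ∈ Ioo 0 E₀ ∧ Bif2I c N δ (E2I δ)) ∧
      (2 * (c.C - c.A) < c.B →
        HasExpansion N E2L (lead2L c) (quad2L c) ∧
        ∀ δ ∈ Ioo (-δ₀) 0, E2L δ ∈ Ioo 0 E₀ ∧ Bif2L c N δ (E2L δ)) ∧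
      (0 < c.B →
        AgreeToFirstOrder N EGB (fun δ => leadGB c * δ) ∧
        ∀ δ ∈ Ioo (-δ₀) 0, EGB δ ∈ Ioo 0 E₀ ∧ BifGB c N δ (EGB δ)) ∧
      -- the fixed points in general position are inclined or loop, and stable
      (∀ δ ∈ Ioo (-δ₀) 0, ∀ E ∈ Ioo 0 E₀, ∀ p : ℝ × ℝ, p.1 ∈ Ioo 0 E →
        IsEquilibrium (ham c N δ E) p →
          IsCenter (ham c N δ E) p ∧ (Real.sin p.2 = 0 ∨ Real.cos p.2 = 0)) ∧
      -- concurrent bifurcations for `A = 2C`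
      (c.A = 2 * c.C →
        (2 * c.C < c.B → AgreeToFirstOrder N E1L E2I) ∧
        (-2 * c.C < c.B → AgreeToFirstOrder N E1I E2L)) ∧
      -- the full bifurcation sequence, when all the thresholds are positive
      (2 * (c.A - 3 * c.C) < c.B → 2 * (c.A - c.C) < c.B → 2 * (3 * c.C - c.A) < c.B →
        2 * (c.C - c.A) < c.B → 0 < c.B →
        ∀ δ ∈ Ioo (-δ₀) 0,
          {E ∈ Ioo 0 E₀ | ¬ IsRegularEnergy c N δ E} = {E1I δ, E1L δ, E2I δ, E2L δ, EGB δ} ∧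
          (c.A - 2 * c.C < 0 →
            E1L δ < E2I δ ∧ E2I δ < EGB δ ∧ EGB δ < E1I δ ∧ E1I δ < E2L δ) ∧
          (0 < c.A - 2 * c.C →
            E2I δ < E1L δ ∧ E1L δ < EGB δ ∧ EGB δ < E2L δ ∧ E2L δ < E1I δ) ∧
          (c.A = 2 * c.C →
            E1L δ < EGB δ ∧ E2I δ < EGB δ ∧ EGB δ < E1I δ ∧ EGB δ < E2L δ)) := by
  have j1I : 2 * (c.A - 3 * c.C) < c.B → 0 < m1I c := fun h => by unfold m1I; linarith
  have j1L : 2 * (c.A - c.C) < c.B → 0 < m1L c := fun h => by unfold m1L; linarith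
  have j2I : 2 * (3 * c.C - c.A) < c.B → 0 < m2I c := fun h => by unfold m2I; linarith
  have j2L : 2 * (c.C - c.A) < c.B → 0 < m2L c := fun h => by unfold m2L; linarith
  have jGB : 0 < c.B → 0 < mGB c := fun h => by unfold mGB; linarith
  set n : ℝ := (N : ℝ) - 1 with hn
  -- a threshold with `m ≤ 0` imposes no condition on `E₀` and `δ₀`
  have guard : ∀ {m : ℝ} {P : ℝ → ℝ → Prop},
      (0 < m → ∀ᶠ E₀ in 𝓝[>] (0 : ℝ), ∀ᶠ δ in 𝓝[<] (0 : ℝ), P E₀ δ) →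
      ∀ᶠ E₀ in 𝓝[>] (0 : ℝ), ∀ᶠ δ in 𝓝[<] (0 : ℝ), 0 < m → P E₀ δ := by
    intro m P h
    by_cases hm : 0 < m
    · exact (h hm).mono fun _ h => h.mono fun _ h _ => h
    · exact Eventually.of_forall fun _ => Eventually.of_forall fun _ h => absurd h hm
  have e1I := guard fun h : 0 < m1I c => eventually_signChange h (incl1_eq c n)
  have e1L := guard fun h : 0 < m1L c => eventually_signChange h (loop1_eq c n)
  have e2I := guard fun h : 0 < m2I c => eventually_signChange h (inclEnd_eq c n)
  have e2L := guard fun h : 0 < m2L c => eventually_signChange h (loopEnd_eq c n)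
  have eGB := guard fun h : 0 < mGB c => eventually_signChange h (meanSlope_eq c n)
  obtain ⟨E₀, hE₀, hE₀pos⟩ := ((eventually_isSmall hP hQ n).and (e1I.and (e1L.and (e2I.and
    (e2L.and eGB)))) |>.and self_mem_nhdsWithin).exists
  obtain ⟨d1, d2, d3, d4, d5, d6⟩ := hE₀
  obtain ⟨l, hl, hsub⟩ := mem_nhdsLT_iff_exists_Ioo_subset.1
    (d1.and (d2.and (d3.and (d4.and (d5.and d6)))))
  have hl0 : l < 0 := hl
  have hall : ∀ δ ∈ Ioo (- -l) 0, _ := fun δ hδ => hsub (by rwa [neg_neg] at hδ)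
  refine ⟨-l, neg_pos.2 hl0, E₀, hE₀pos, threshold (m1I c) (n * α1I c) (n * β1I c),
    threshold (m1L c) (n * α1L c) (n * β1L c), threshold (m2I c) (n * α2I c) (n * β2I c),
    threshold (m2L c) (n * α2L c) (n * β2L c), threshold (mGB c) (n * αGB c) (n * βGB c),
    fun h => ⟨expansion_1I (j1I h) N, fun δ hδ => ?_⟩,
    fun h => ⟨expansion_1L (j1L h) N, fun δ hδ => ?_⟩,
    fun h => ⟨expansion_2I (j2I h) N, fun δ hδ => ?_⟩,
    fun h => ⟨expansion_2L (j2L h) N, fun δ hδ => ?_⟩,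
    fun h => ⟨agree_GB (jGB h) N, fun δ hδ => ?_⟩, fun δ hδ E hE p hp h => ?_,
    fun hA => ⟨fun h => ?_, fun h => ?_⟩, fun q1 q2 q3 q4 q5 δ hδ => ?_⟩
  · obtain ⟨hs, f, -⟩ := hall δ hδ
    exact ⟨(f (j1I h)).1, bif1I_of_signChange hN (f (j1I h)) (hs _ (f (j1I h)).1)⟩
  · obtain ⟨hs, -, f, -⟩ := hall δ hδ
    exact ⟨(f (j1L h)).1, bif1L_of_signChange hN (f (j1L h)) (hs _ (f (j1L h)).1)⟩
  · obtain ⟨hs, -, -, f, -⟩ := hall δ hδ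
    exact ⟨(f (j2I h)).1, bif2I_of_signChange hN (f (j2I h)) (hs _ (f (j2I h)).1)⟩
  · obtain ⟨hs, -, -, -, f, -⟩ := hall δ hδ
    exact ⟨(f (j2L h)).1, bif2L_of_signChange hN (f (j2L h)) (hs _ (f (j2L h)).1)⟩
  · obtain ⟨hs, -, -, -, -, f⟩ := hall δ hδ
    exact ⟨(f (jGB h)).1, bifGB_of_signChange hN (f (jGB h)) hs⟩
  · exact isCenter_of_isEquilibrium hN ((hall δ hδ).1 E hE) hp h
  · have h2 := expansion_2I (j2I (by linarith)) N
    rw [show lead2I c = lead1L c by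
      rw [lead2I, lead1L, hA, ← neg_div_neg_eq]
      congr 1 <;> ring] at h2
    exact (expansion_1L (j1L (by linarith)) N).agree h2
  · have h2 := expansion_2L (j2L (by linarith)) N
    rw [show lead2L c = lead1I c by
      rw [lead2L, lead1I, hA, ← neg_div_neg_eq]
      congr 1 <;> ring] at h2
    exact (expansion_1I (j1I (by linarith)) N).agree h2
  · obtain ⟨hs, f1, f2, f3, f4, f5⟩ := hall δ hδ
    exact bifurcation_sequence hN hs (f1 (j1I q1)) (f2 (j1L q2)) (f3 (j2I q3)) (f4 (j2L q4))
      (f5 (jGB q5))
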